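/- For an odd prime $p$, let $T$ be the $p$-regular rooted tree whose vertices are the finite words over $\{0,\dots,p-1\}$, and let $G=\langle a,b\rangle\le\operatorname{Aut}T$ be the Gupta–Sidki $p$-group: $a$ cyclically permutes the $p$ subtrees rooted at the first level, $a(iw)=((i+1)\bmod p)\,w$, and $b=(a,a^{-1},1,\dots,1,b)$ fixes the first level and acts as $a$ on the subtree at $0$, as $a^{-1}$ on the subtree at $1$, as $b$ on the subtree at $p-1$, and trivially on the other first-level subtrees. Two groups are called commensurable if they have isomorphic subgroups of finite index. (1) Let $p$ be an odd prime, let $k\ge 0$, and let $G^k$ be the direct product of $k$ copies of the Gupta–Sidki $p$-group $G$. If $H$ is a group commensurable with $G^k$, then every maximal subgroup of $H$ has finite index in $H$. (2) If $H$ is a finitely generated subgroup of the Gupta–Sidki $3$-group, then every maximal subgroup of $H$ has finite index in $H$. -/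

import Mathlib

namespace GuptaSidki

/-- The regular rooted tree on the finite words over the alphabet `X`: the root is the empty word,
and two words are joined by an edge when one of them is the other followed by one letter. -/
def wordTree (X : Type*) : SimpleGraph (List X) where
  Adj u v := (∃ x, v = u ++ [x]) ∨ (∃ x, u = v ++ [x])
  symm := ⟨fun _ _ h => h.symm⟩
  loopless := ⟨fun u h => by rcases h with ⟨x, h⟩ | ⟨x, h⟩ <;> simp at h⟩

/-- The automorphism group of the tree of words: the permutations of the vertices that preserve
adjacency. Multiplication is composition. -/
abbrev AutTree (X : Type*) : Type _ := wordTree X ≃g wordTree X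

theorem adj_of_children {X : Type*} {f : List X → List X}
    (hf : ∀ u x, ∃ y, f (u ++ [x]) = f u ++ [y]) {u v : List X} (h : (wordTree X).Adj u v) :
    (wordTree X).Adj (f u) (f v) := by
  rcases h with ⟨x, rfl⟩ | ⟨x, rfl⟩
  · exact Or.inl (hf u x)
  · exact Or.inr (hf v x)

/-- Two mutually inverse maps on words that carry children to children form a tree automorphism. -/
def mkAut {X : Type*} (f g : List X → List X) (hgf : ∀ u, g (f u) = u) (hfg : ∀ u, f (g u) = u)
    (hf : ∀ u x, ∃ y, f (u ++ [x]) = f u ++ [y])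
    (hg : ∀ u x, ∃ y, g (u ++ [x]) = g u ++ [y]) : AutTree X where
  toFun := f
  invFun := g
  left_inv := hgf
  right_inv := hfg
  map_rel_iff' := by
    intro u v
    refine ⟨fun h => ?_, fun h => adj_of_children hf h⟩
    have h2 := adj_of_children hg h
    simpa [hgf] using h2

/-! From here on the alphabet `{0, …, p - 1}` is `ZMod p`, so that the last letter `p - 1` is `-1`. -/

/-- Add `k` to the first letter of a word. -/
def shift {p : ℕ} (k : ZMod p) : List (ZMod p) → List (ZMod p)
  | [] => []
  | i :: w => (i + k) :: w

theorem shift_shift {p : ℕ} {k l : ZMod p} (h : k + l = 0) (u : List (ZMod p)) :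
    shift l (shift k u) = u := by
  cases u with
  | nil => rfl
  | cons i w => simp [shift, add_assoc, h]

theorem shift_append {p : ℕ} (k : ZMod p) (u : List (ZMod p)) (x : ZMod p) :
    ∃ y, shift k (u ++ [x]) = shift k u ++ [y] := by
  cases u with
  | nil => exact ⟨x + k, rfl⟩
  | cons i w => exact ⟨x, rfl⟩

/-- The generator `a`: it cyclically permutes the `p` subtrees rooted at the first layer,
`a (i w) = (i + 1) w`. -/
def a (p : ℕ) : AutTree (ZMod p) :=
  mkAut (shift 1) (shift (-1)) (shift_shift (by simp)) (shift_shift (by simp))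
    (shift_append 1) (shift_append (-1))

/-- The map on words that fixes every first letter and acts below the first layer as
`(s, t, 1, …, 1, itself)`: as `s` below `0`, as `t` below `1`, as itself below the last letter
`p - 1`, and trivially below the other letters. -/
def spinal {p : ℕ} (s t : AutTree (ZMod p)) : List (ZMod p) → List (ZMod p)
  | [] => []
  | i :: w =>
    if i = 0 then i :: s w
    else if i = 1 then i :: t w
    else if i = -1 then i :: spinal s t w
    else i :: w

theorem spinal_spinal {p : ℕ} {s t s' t' : AutTree (ZMod p)} (hs : ∀ u, s' (s u) = u)
    (ht : ∀ u, t' (t u) = u) (u : List (ZMod p)) : spinal s' t' (spinal s t u) = u := by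
  induction u with
  | nil => rfl
  | cons i w ih =>
    by_cases h0 : i = 0
    · simp [spinal, h0, hs]
    by_cases h1 : i = 1
    · subst h1; simp [spinal, h0, ht]
    by_cases h2 : i = -1
    · subst h2; simp only [spinal, h0, h1, if_true, if_false, ih]
    · simp [spinal, h0, h1, h2]

theorem spinal_append {p : ℕ} {s t : AutTree (ZMod p)}
    (hs : ∀ u x, ∃ y, s (u ++ [x]) = s u ++ [y]) (ht : ∀ u x, ∃ y, t (u ++ [x]) = t u ++ [y])
    (hs0 : s [] = []) (ht0 : t [] = []) (u : List (ZMod p)) (x : ZMod p) :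
    ∃ y, spinal s t (u ++ [x]) = spinal s t u ++ [y] := by
  induction u with
  | nil => exact ⟨x, by simp [spinal, hs0, ht0]⟩
  | cons i w ih =>
    obtain ⟨y0, hy0⟩ := hs w x
    obtain ⟨y1, hy1⟩ := ht w x
    obtain ⟨y2, hy2⟩ := ih
    by_cases h0 : i = 0
    · exact ⟨y0, by simp [spinal, h0, hy0]⟩
    by_cases h1 : i = 1
    · exact ⟨y1, by subst h1; simp [spinal, h0, hy1]⟩
    by_cases h2 : i = -1
    · exact ⟨y2, by subst h2; simp [spinal, h0, h1, hy2]⟩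
    · exact ⟨x, by simp [spinal, h0, h1, h2]⟩

/-- The generator `b = (a, a⁻¹, 1, …, 1, b)`. -/
def b (p : ℕ) : AutTree (ZMod p) :=
  mkAut (spinal (a p) (a p)⁻¹) (spinal (a p)⁻¹ (a p))
    (spinal_spinal (fun u => (a p).left_inv u) (fun u => (a p).right_inv u))
    (spinal_spinal (fun u => (a p).right_inv u) (fun u => (a p).left_inv u))
    (spinal_append (shift_append 1) (shift_append (-1)) rfl rfl)
    (spinal_append (shift_append (-1)) (shift_append 1) rfl rfl)

end GuptaSidki

/-- The Gupta–Sidki `p`-group `⟨a, b⟩`, a subgroup of the automorphism group of the `p`-regular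
rooted tree. -/
def guptaSidkiGroup (p : ℕ) : Subgroup (GuptaSidki.AutTree (ZMod p)) :=
  Subgroup.closure {GuptaSidki.a p, GuptaSidki.b p}

/-- Abstract commensurability: `G` and `H` have isomorphic subgroups of finite index. -/
def AbstractlyCommensurable (G H : Type*) [Group G] [Group H] : Prop :=
  ∃ (K : Subgroup G) (L : Subgroup H), K.FiniteIndex ∧ L.FiniteIndex ∧ Nonempty (K ≃* L)

/-!
A maximal subgroup of infinite index is dense in the profinite topology, so it suffices that the
whole group is its only dense subgroup. If `M` is dense in the Gupta–Sidki group `G`, its sections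
are dense too, and a section equal to `G` forces `M = G`. Taking sections shortens the elements, so
some iterated section of an element with nonzero `b`-exponent is a conjugate of `b`; iterating, one
reaches a section of `M` that contains both generators.

Being the only dense subgroup of oneself, together with residual finiteness of all quotients, passes
to finite-index overgroups and to subdirect products. A finite-index subgroup of `G` is treated
through its sections, and this settles all groups commensurable with a power of `G`.

For `p = 3`, a finitely generated subgroup is treated by induction on the length of its generators:
either it has rank two modulo the commutator subgroup, which already makes it `G`, or its sections
are generated in shorter length.
-/

/-! ### Subgroups in the profinite topology -/

section Profinite

variable {H K : Type*} [Group H] [Group K]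

/-- Density in the profinite topology of `H`, whose basic open sets are the cosets of the subgroups
of finite index: no proper subgroup of finite index contains `M`. -/
def IsProfinitelyDense (M : Subgroup H) : Prop :=
  ∀ F : Subgroup H, M ≤ F → F.FiniteIndex → F = ⊤

/-- Closedness in the profinite topology: `C` is an intersection of subgroups of finite index. -/
def IsProfinitelyClosed (C : Subgroup H) : Prop :=
  ∀ x ∉ C, ∃ F : Subgroup H, F.FiniteIndex ∧ C ≤ F ∧ x ∉ F

/-- Every quotient of `H ⧸ N` is residually finite, expressed by the normal subgroups of `H` that
contain `N`. -/
def HasResiduallyFiniteQuotients (N : Subgroup H) : Prop :=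
  ∀ C : Subgroup H, C.Normal → N ≤ C → IsProfinitelyClosed C

theorem sup_inf_assoc_of_le_of_normal_right {A C : Subgroup H} (B : Subgroup H) [B.Normal]
    (hAC : A ≤ C) : (A ⊔ B) ⊓ C = A ⊔ B ⊓ C := by
  refine le_antisymm ?_ (le_inf (sup_le_sup_left inf_le_left A) (sup_le hAC inf_le_right))
  rintro _ ⟨hx, hxC⟩
  obtain ⟨a, ha, b, hb, rfl⟩ := Subgroup.mem_sup_of_normal_right.1 hx
  exact Subgroup.mul_mem_sup ha ⟨hb, (Subgroup.mul_mem_cancel_left C (hAC ha)).1 hxC⟩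

theorem sup_inf_assoc_of_le_of_normal_left {A C : Subgroup H} [A.Normal] (B : Subgroup H)
    (hAC : A ≤ C) : (A ⊔ B) ⊓ C = A ⊔ B ⊓ C := by
  refine le_antisymm ?_ (le_inf (sup_le_sup_left inf_le_left A) (sup_le hAC inf_le_right))
  rintro _ ⟨hx, hxC⟩
  obtain ⟨a, ha, b, hb, rfl⟩ := Subgroup.mem_sup_of_normal_left.1 hx
  exact Subgroup.mul_mem_sup ha ⟨hb, (Subgroup.mul_mem_cancel_left C (hAC ha)).1 hxC⟩

theorem relIndex_ne_zero_of_finiteIndex (F L : Subgroup H) [F.FiniteIndex] : F.relIndex L ≠ 0 :=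
  fun h => Subgroup.FiniteIndex.index_ne_zero (Subgroup.index_eq_zero_of_relIndex_eq_zero h)

theorem finiteIndex_comap (F : Subgroup K) [F.FiniteIndex] (f : H →* K) :
    (F.comap f).FiniteIndex :=
  ⟨by rw [Subgroup.index_comap]; exact relIndex_ne_zero_of_finiteIndex F _⟩

theorem finiteIndex_map (F : Subgroup H) [F.FiniteIndex] {f : H →* K}
    (hf : Function.Surjective f) : (F.map f).FiniteIndex :=
  ⟨ne_zero_of_dvd_ne_zero Subgroup.FiniteIndex.index_ne_zero (F.index_map_dvd hf)⟩

theorem finiteIndex_map_subtype {L : Subgroup H} [L.FiniteIndex] (F : Subgroup L)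
    [F.FiniteIndex] : (F.map L.subtype).FiniteIndex :=
  ⟨by
    rw [Subgroup.index_map_subtype]
    exact mul_ne_zero Subgroup.FiniteIndex.index_ne_zero Subgroup.FiniteIndex.index_ne_zero⟩

theorem finiteIndex_of_sup_eq_top {F N : Subgroup H} [N.Normal] (hFN : F ⊔ N = ⊤)
    (hrel : F.relIndex N ≠ 0) : F.FiniteIndex := by
  have : (F.subgroupOf N).FiniteIndex := ⟨hrel⟩
  let coset : N ⧸ F.subgroupOf N → H ⧸ F :=
    Quotient.map' Subtype.val fun x y hxy => by
      rw [QuotientGroup.leftRel_apply] at hxy ⊢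
      simpa [Subgroup.mem_subgroupOf] using hxy
  have hcoset : Function.Surjective coset := by
    rintro ⟨x⟩
    obtain ⟨n, hn, f, hf, rfl⟩ :=
      Subgroup.mem_sup_of_normal_left.1 (by rw [sup_comm, hFN]; trivial : x ∈ N ⊔ F)
    exact ⟨QuotientGroup.mk ⟨n, hn⟩, QuotientGroup.eq.2 (by simpa using hf)⟩
  have : Finite (H ⧸ F) := .of_surjective coset hcoset
  exact Subgroup.finiteIndex_of_finite_quotient

namespace IsProfinitelyDense

theorem eq_top_of_finiteIndex {M : Subgroup H} (hM : IsProfinitelyDense M) [hfin : M.FiniteIndex] :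
    M = ⊤ :=
  hM M le_rfl hfin

theorem map {M : Subgroup H} (hM : IsProfinitelyDense M) {f : H →* K}
    (hf : Function.Surjective f) : IsProfinitelyDense (M.map f) := by
  intro F hMF _
  refine Subgroup.comap_injective hf ?_
  rw [hM (F.comap f) (Subgroup.map_le_iff_le_comap.1 hMF) (finiteIndex_comap F f),
    Subgroup.comap_top]

theorem comap {M : Subgroup K} (hM : IsProfinitelyDense M) {f : H →* K}
    (hf : Function.Surjective f) : IsProfinitelyDense (M.comap f) := by
  intro F hMF _
  have hmap : F.map f = ⊤ := by
    refine hM _ ?_ (finiteIndex_map F hf)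
    rw [← Subgroup.map_comap_eq_self_of_surjective hf M]
    exact Subgroup.map_mono hMF
  have hker : f.ker ≤ F := (f.ker_le_comap M).trans hMF
  rw [← Subgroup.comap_map_eq_self hker, hmap, Subgroup.comap_top]

theorem sup_eq_top {M : Subgroup H} (hM : IsProfinitelyDense M) (N : Subgroup H) [N.FiniteIndex] :
    M ⊔ N = ⊤ :=
  hM _ le_sup_left (Subgroup.finiteIndex_of_le le_sup_right)

theorem subgroupOf {M : Subgroup H} (hM : IsProfinitelyDense M) (L : Subgroup H)
    [L.FiniteIndex] : IsProfinitelyDense (M.subgroupOf L) := by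
  intro F hMF _
  have := finiteIndex_map_subtype F
  set N := (F.map L.subtype).normalCore
  have hN : N ≤ F.map L.subtype := Subgroup.normalCore_le _
  have hML : M ⊓ L ≤ F.map L.subtype := by
    rw [← Subgroup.subgroupOf_map_subtype]
    exact Subgroup.map_mono hMF
  have hL : L ≤ F.map L.subtype :=
    calc
      L = (N ⊔ M) ⊓ L := by rw [sup_comm, hM.sup_eq_top N, top_inf_eq]
      _ = N ⊔ M ⊓ L := sup_inf_assoc_of_le_of_normal_left M (hN.trans (Subgroup.map_subtype_le F))
      _ ≤ F.map L.subtype := sup_le hN hML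
  rw [← Subgroup.comap_map_eq_self_of_injective L.subtype_injective F]
  exact Subgroup.subgroupOf_eq_top.2 hL

end IsProfinitelyDense

namespace IsProfinitelyClosed

theorem of_finiteIndex (C : Subgroup H) [hC : C.FiniteIndex] : IsProfinitelyClosed C :=
  fun _ hx => ⟨C, hC, le_rfl, hx⟩

theorem exists_normal {C : Subgroup H} [C.Normal] (hC : IsProfinitelyClosed C) {x : H}
    (hx : x ∉ C) : ∃ L : Subgroup H, L.Normal ∧ L.FiniteIndex ∧ C ≤ L ∧ x ∉ L := by
  obtain ⟨F, _, hCF, hxF⟩ := hC x hx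
  exact ⟨F.normalCore, inferInstance, inferInstance, Subgroup.normal_le_normalCore.2 hCF,
    fun h => hxF (Subgroup.normalCore_le _ h)⟩

theorem comap {C : Subgroup K} (hC : IsProfinitelyClosed C) (f : H →* K) :
    IsProfinitelyClosed (C.comap f) := by
  intro x hx
  obtain ⟨F, _, hCF, hxF⟩ := hC (f x) hx
  exact ⟨F.comap f, finiteIndex_comap F f, Subgroup.comap_mono hCF, hxF⟩

theorem of_comap {C : Subgroup K} {f : H →* K} (hf : Function.Surjective f)
    (hC : IsProfinitelyClosed (C.comap f)) : IsProfinitelyClosed C := by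
  intro y hy
  obtain ⟨x, rfl⟩ := hf y
  obtain ⟨F, _, hCF, hxF⟩ := hC x hy
  refine ⟨F.map f, finiteIndex_map F hf, ?_, fun hx => hxF ?_⟩
  · rw [← Subgroup.map_comap_eq_self_of_surjective hf C]
    exact Subgroup.map_mono hCF
  · rwa [← Subgroup.comap_map_eq_self ((f.ker_le_comap C).trans hCF)]

theorem map_subtype {L : Subgroup H} [L.FiniteIndex] {C : Subgroup L}
    (hC : IsProfinitelyClosed C) : IsProfinitelyClosed (C.map L.subtype) := by
  intro x hx
  by_cases hxL : x ∈ L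
  · obtain ⟨F, _, hCF, hxF⟩ := hC ⟨x, hxL⟩ fun h => hx ⟨_, h, rfl⟩
    refine ⟨F.map L.subtype, finiteIndex_map_subtype F, Subgroup.map_mono hCF, ?_⟩
    rintro ⟨y, hy, rfl⟩
    exact hxF hy
  · exact ⟨L, inferInstance, Subgroup.map_subtype_le C, hxL⟩

theorem of_sup {C N : Subgroup H} [N.Normal] (hCN : IsProfinitelyClosed (C ⊔ N))
    (hN : ∀ y ∈ N, y ∉ C → ∃ F : Subgroup H, F.FiniteIndex ∧ C ≤ F ∧ y ∉ F) :
    IsProfinitelyClosed C := by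
  intro x hx
  by_cases hxCN : x ∈ C ⊔ N
  · obtain ⟨c, hc, y, hy, rfl⟩ := Subgroup.mem_sup_of_normal_right.1 hxCN
    obtain ⟨F, hF, hCF, hyF⟩ := hN y hy fun hyC => hx (C.mul_mem hc hyC)
    exact ⟨F, hF, hCF, fun h => hyF ((Subgroup.mul_mem_cancel_left F (hCF hc)).1 h)⟩
  · obtain ⟨F, hF, hCNF, hxF⟩ := hCN x hxCN
    exact ⟨F, hF, le_sup_left.trans hCNF, hxF⟩

theorem of_inf_finiteIndex {C : Subgroup H} [C.Normal] (L : Subgroup H) [L.FiniteIndex]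
    (hCL : IsProfinitelyClosed (C ⊓ L)) : IsProfinitelyClosed C := by
  set N := L.normalCore
  have : (C ⊔ N).FiniteIndex := Subgroup.finiteIndex_of_le le_sup_right
  refine of_sup (.of_finiteIndex (C ⊔ N)) fun y hyN hyC => ?_
  obtain ⟨F, _, hCF, hyF⟩ := hCL y fun hy => hyC hy.1
  refine ⟨F ⊓ N ⊔ C, Subgroup.finiteIndex_of_le le_sup_left, le_sup_right, fun hy => hyF ?_⟩
  have hle : (F ⊓ N ⊔ C) ⊓ N ≤ F := by
    rw [sup_inf_assoc_of_le_of_normal_right C inf_le_right]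
    exact sup_le inf_le_left ((inf_le_inf_left C L.normalCore_le).trans hCF)
  exact hle ⟨hy, hyN⟩

theorem exists_finiteIndex_inf_le {U V : Subgroup H} (hU : IsProfinitelyClosed U)
    (hUV : U.relIndex V ≠ 0) : ∃ L : Subgroup H, L.FiniteIndex ∧ U ≤ L ∧ L ⊓ V ≤ U := by
  have : (U.subgroupOf V).FiniteIndex := ⟨hUV⟩
  have hsep (q : V ⧸ U.subgroupOf V) : ∃ F : Subgroup H, F.FiniteIndex ∧ U ≤ F ∧
      ((q.out : H) ∈ F → (q.out : H) ∈ U) := by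
    by_cases hq : (q.out : H) ∈ U
    · exact ⟨⊤, inferInstance, le_top, fun _ => hq⟩
    · obtain ⟨F, hF, hUF, hqF⟩ := hU _ hq
      exact ⟨F, hF, hUF, fun h => absurd h hqF⟩
  choose F hF hUF hout using hsep
  refine ⟨⨅ q, F q, Subgroup.finiteIndex_iInf hF, le_iInf hUF, ?_⟩
  rintro x ⟨hx, hxV⟩
  obtain ⟨u, hu⟩ := QuotientGroup.mk_out_eq_mul (U.subgroupOf V) ⟨x, hxV⟩
  set q : V ⧸ U.subgroupOf V := QuotientGroup.mk ⟨x, hxV⟩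
  have hq : (q.out : H) = x * u := congrArg Subtype.val hu
  have hqU : x * u ∈ U := hq ▸ hout q
    (hq ▸ (F q).mul_mem (Subgroup.mem_iInf.1 hx q) (hUF q u.2))
  exact (Subgroup.mul_mem_cancel_right U u.2).1 hqU

end IsProfinitelyClosed

theorem IsProfinitelyDense.le_of_sup_eq_top {M N L : Subgroup H} [N.Normal] [L.Normal]
    [L.FiniteIndex] (hM : IsProfinitelyDense M) (hMN : M ⊔ N = ⊤) (hL : M ⊓ N ≤ L) : N ≤ L := by
  have hfin : (L ⊓ N ⊔ M).FiniteIndex := by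
    refine finiteIndex_of_sup_eq_top (N := N) ?_ ?_
    · rw [eq_top_iff, ← hMN]
      exact sup_le_sup_right le_sup_right N
    · refine ne_zero_of_dvd_ne_zero ?_ (Subgroup.relIndex_dvd_of_le_left N le_sup_left)
      rw [Subgroup.inf_relIndex_right]
      exact relIndex_ne_zero_of_finiteIndex L N
  calc
    N = (L ⊓ N ⊔ M) ⊓ N := by rw [hM _ le_sup_right hfin, top_inf_eq]
    _ = L ⊓ N ⊔ M ⊓ N := sup_inf_assoc_of_le_of_normal_left M inf_le_right
    _ ≤ L := sup_le inf_le_left hL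

theorem normal_inf_sup {M N₁ N₂ : Subgroup H} [N₁.Normal] [N₂.Normal] (hMN : M ⊔ N₁ = ⊤) :
    (M ⊓ N₂ ⊔ N₁).Normal := by
  rw [← Subgroup.normalizer_eq_top_iff, eq_top_iff, ← hMN]
  refine sup_le (fun m hm => ?_) (le_sup_right.trans Subgroup.le_normalizer)
  have hM : m ∈ Subgroup.normalizer ((M ⊓ N₂ : Subgroup H) : Set H) :=
    Subgroup.inf_normalizer_le_normalizer_inf
      ⟨Subgroup.le_normalizer hm, Subgroup.le_normalizer_of_normal hm⟩
  have hN₁ : m ∈ Subgroup.normalizer (N₁ : Set H) := Subgroup.le_normalizer_of_normal hm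
  rw [Subgroup.mem_normalizer_iff_map_conj_eq] at hM hN₁ ⊢
  rw [Subgroup.map_sup, hM, hN₁]

namespace HasResiduallyFiniteQuotients

theorem ker (hK : HasResiduallyFiniteQuotients (⊥ : Subgroup K)) {f : H →* K}
    (hf : Function.Surjective f) : HasResiduallyFiniteQuotients f.ker := by
  intro C hC hker
  rw [← Subgroup.comap_map_eq_self hker]
  exact (hK _ (hC.map f hf) bot_le).comap f

theorem sup_inf_eq_top {M N₁ N₂ : Subgroup H} [N₁.Normal] [N₂.Normal]
    (hN₁ : HasResiduallyFiniteQuotients N₁) (hM : IsProfinitelyDense M) (h₁ : M ⊔ N₁ = ⊤)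
    (h₂ : M ⊔ N₂ = ⊤) : M ⊔ N₁ ⊓ N₂ = ⊤ := by
  have hnormal := normal_inf_sup (N₂ := N₂) h₁
  have hN₂ : N₂ ≤ M ⊓ N₂ ⊔ N₁ := by
    intro x hx
    by_contra hxC
    obtain ⟨L, _, _, hCL, hxL⟩ := (hN₁ _ hnormal le_sup_right).exists_normal hxC
    exact hxL (hM.le_of_sup_eq_top h₂ (le_sup_left.trans hCL) hx)
  rw [eq_top_iff, ← h₂]
  refine sup_le le_sup_left ?_
  calc
    N₂ = (M ⊓ N₂ ⊔ N₁) ⊓ N₂ := (inf_eq_right.2 hN₂).symm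
    _ = M ⊓ N₂ ⊔ N₁ ⊓ N₂ := sup_inf_assoc_of_le_of_normal_right N₁ inf_le_right
    _ ≤ M ⊔ N₁ ⊓ N₂ := sup_le_sup_right inf_le_left _

theorem inf {N₁ N₂ : Subgroup H} [N₁.Normal] [N₂.Normal]
    (h₁ : HasResiduallyFiniteQuotients N₁) (h₂ : HasResiduallyFiniteQuotients N₂) :
    HasResiduallyFiniteQuotients (N₁ ⊓ N₂) := by
  intro C _ hC
  refine .of_sup (h₁ (C ⊔ N₁) inferInstance le_sup_right) fun y hyN₁ hyC => ?_
  have hy : y ∉ C ⊓ N₁ ⊔ N₂ := fun hy => hyC <| by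
    have hle : (C ⊓ N₁ ⊔ N₂) ⊓ N₁ ≤ C := by
      rw [sup_inf_assoc_of_le_of_normal_right N₂ inf_le_right, inf_comm N₂]
      exact sup_le inf_le_left hC
    exact hle ⟨hy, hyN₁⟩
  obtain ⟨L, _, _, hL, hyL⟩ := (h₂ _ inferInstance le_sup_right).exists_normal hy
  have hrel : (C ⊓ L ⊔ N₁).relIndex C ≠ 0 := by
    refine ne_zero_of_dvd_ne_zero ?_ (Subgroup.relIndex_dvd_of_le_left C le_sup_left)
    rw [Subgroup.inf_relIndex_left]
    exact relIndex_ne_zero_of_finiteIndex L C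
  obtain ⟨L', _, hL', hL'C⟩ :=
    (h₁ (C ⊓ L ⊔ N₁) inferInstance le_sup_right).exists_finiteIndex_inf_le hrel
  refine ⟨L ⊓ L' ⊔ C, Subgroup.finiteIndex_of_le le_sup_left, le_sup_right, fun hy => hyL ?_⟩
  have hCL' : C ⊓ L' ≤ L :=
    calc
      C ⊓ L' ≤ (C ⊓ L ⊔ N₁) ⊓ C := le_inf ((inf_comm C L').le.trans hL'C) inf_le_left
      _ = C ⊓ L ⊔ N₁ ⊓ C := sup_inf_assoc_of_le_of_normal_right N₁ inf_le_left
      _ ≤ L := sup_le inf_le_right ((inf_comm N₁ C).le.trans (le_sup_left.trans hL))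
  have hle : (L ⊓ L' ⊔ C) ⊓ L' ≤ L := by
    rw [sup_inf_assoc_of_le_of_normal_right C inf_le_right]
    exact sup_le inf_le_left hCL'
  exact hle ⟨hy, hL' (Subgroup.mem_sup_right hyN₁)⟩

theorem normal_and_finset_inf {ι : Type*} {N : ι → Subgroup H} (hnormal : ∀ i, (N i).Normal)
    (hN : ∀ i, HasResiduallyFiniteQuotients (N i)) (s : Finset ι) :
    (s.inf N).Normal ∧ HasResiduallyFiniteQuotients (s.inf N) := by
  induction s using Finset.cons_induction with
  | empty =>
    rw [Finset.inf_empty]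
    refine ⟨inferInstance, fun C _ hC => ?_⟩
    rw [top_le_iff.1 hC]
    exact .of_finiteIndex ⊤
  | cons i s _ ih =>
    have := hnormal i
    have := ih.1
    rw [Finset.inf_cons]
    exact ⟨inferInstance, (hN i).inf ih.2⟩

theorem sup_finset_inf_eq_top {ι : Type*} {N : ι → Subgroup H} (hnormal : ∀ i, (N i).Normal)
    (hN : ∀ i, HasResiduallyFiniteQuotients (N i)) {M : Subgroup H} (hM : IsProfinitelyDense M)
    (hsup : ∀ i, M ⊔ N i = ⊤) (s : Finset ι) : M ⊔ s.inf N = ⊤ := by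
  induction s using Finset.cons_induction with
  | empty => rw [Finset.inf_empty, sup_top_eq]
  | cons i s _ ih =>
    have := hnormal i
    have := (normal_and_finset_inf hnormal hN s).1
    rw [Finset.inf_cons]
    exact (hN i).sup_inf_eq_top hM (hsup i) ih

end HasResiduallyFiniteQuotients

/-- A group in which the only subgroup dense in the profinite topology is the whole group, and all
of whose quotients are residually finite. The second condition is what makes the first one pass to
subdirect products. -/
structure IsTameGroup (H : Type*) [Group H] : Prop where
  eq_top_of_isProfinitelyDense : ∀ M : Subgroup H, IsProfinitelyDense M → M = ⊤
  hasResiduallyFiniteQuotients : HasResiduallyFiniteQuotients (⊥ : Subgroup H)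

namespace IsTameGroup

theorem finiteIndex_of_isCoatom (hH : IsTameGroup H) {M : Subgroup H} (hM : IsCoatom M) :
    M.FiniteIndex := by
  by_contra hfin
  refine hM.1 (hH.eq_top_of_isProfinitelyDense M fun F hMF hF => ?_)
  exact (hM.le_iff.1 hMF).resolve_right fun h => hfin (h ▸ hF)

theorem of_finite [Finite H] : IsTameGroup H :=
  ⟨fun _ hM => hM.eq_top_of_finiteIndex, fun C _ _ => .of_finiteIndex C⟩

theorem of_surjective (hH : IsTameGroup H) {f : H →* K} (hf : Function.Surjective f) :
    IsTameGroup K where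
  eq_top_of_isProfinitelyDense M hM := by
    rw [← Subgroup.map_comap_eq_self_of_surjective hf M,
      hH.eq_top_of_isProfinitelyDense _ (hM.comap hf), Subgroup.map_top_of_surjective f hf]
  hasResiduallyFiniteQuotients _ _ _ :=
    .of_comap hf (hH.hasResiduallyFiniteQuotients _ inferInstance bot_le)

theorem of_mulEquiv (hH : IsTameGroup H) (e : H ≃* K) : IsTameGroup K :=
  hH.of_surjective (f := e.toMonoidHom) e.surjective

theorem of_subdirect {ι : Type*} [Finite ι] {A : ι → Type*} [∀ i, Group (A i)]
    (hA : ∀ i, IsTameGroup (A i)) (f : ∀ i, H →* A i) (hf : ∀ i, Function.Surjective (f i))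
    (hker : ⨅ i, (f i).ker = ⊥) : IsTameGroup H := by
  have := Fintype.ofFinite ι
  have hnormal (i) : (f i).ker.Normal := inferInstance
  have hquot (i) := (hA i).hasResiduallyFiniteQuotients.ker (hf i)
  rw [← Finset.inf_univ_eq_iInf] at hker
  constructor
  · intro M hM
    have hsup (i) : M ⊔ (f i).ker = ⊤ := by
      rw [← Subgroup.comap_map_eq, (hA i).eq_top_of_isProfinitelyDense _ (hM.map (hf i)),
        Subgroup.comap_top]
    simpa only [hker, sup_bot_eq] using
      HasResiduallyFiniteQuotients.sup_finset_inf_eq_top hnormal hquot hM hsup Finset.univ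
  · exact hker ▸ (HasResiduallyFiniteQuotients.normal_and_finset_inf hnormal hquot _).2

theorem of_finiteIndex (L : Subgroup H) [L.FiniteIndex] (hL : IsTameGroup L) :
    IsTameGroup H where
  eq_top_of_isProfinitelyDense M hM := by
    have hLM : L ≤ M :=
      Subgroup.subgroupOf_eq_top.1 (hL.eq_top_of_isProfinitelyDense _ (hM.subgroupOf L))
    have := Subgroup.finiteIndex_of_le hLM
    exact hM.eq_top_of_finiteIndex
  hasResiduallyFiniteQuotients C _ _ := by
    have hCL := (hL.hasResiduallyFiniteQuotients (C.subgroupOf L) inferInstance bot_le).map_subtype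
    rw [Subgroup.subgroupOf_map_subtype] at hCL
    exact hCL.of_inf_finiteIndex L

theorem of_le {N L : Subgroup H} (hNL : N ≤ L) (hrel : N.relIndex L ≠ 0) (hN : IsTameGroup N) :
    IsTameGroup L := by
  have : (N.subgroupOf L).FiniteIndex := ⟨hrel⟩
  exact of_finiteIndex (N.subgroupOf L) (hN.of_mulEquiv (Subgroup.subgroupOfEquivOfLe hNL).symm)

end IsTameGroup

theorem commutator_le_of_isCoatom [Group.IsNilpotent H] {M : Subgroup H} (hM : IsCoatom M) :
    commutator H ≤ M := by
  have hnormal : M.Normal := Subgroup.NormalizerCondition.normal_of_coatom M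
    Group.normalizerCondition_of_isNilpotent hM
  by_contra hle
  have hsup : M ⊔ commutator H = ⊤ := hM.2 _ (left_lt_sup.2 hle)
  have : Nontrivial (H ⧸ M) := QuotientGroup.nontrivial_iff.2 hM.1
  refine (Group.IsSolvable.commutator_lt_top_of_nontrivial (H ⧸ M)).ne ?_
  have hmap := congrArg (Subgroup.map (QuotientGroup.mk' M)) hsup
  rw [Subgroup.map_sup, QuotientGroup.map_mk'_self, bot_sup_eq, commutator_def,
    Subgroup.map_commutator, ← MonoidHom.range_eq_map, QuotientGroup.range_mk'] at hmap
  exact hmap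

theorem IsTameGroup.eq_top_of_sup_commutator_eq_top (hH : IsTameGroup H) {p : ℕ} [Fact p.Prime]
    (hp : IsPGroup p H) {M : Subgroup H} (hM : M ⊔ commutator H = ⊤) : M = ⊤ := by
  refine hH.eq_top_of_isProfinitelyDense M fun F hMF _ => ?_
  set π := QuotientGroup.mk' F.normalCore
  have hπ : Function.Surjective π := QuotientGroup.mk'_surjective _
  have hker : π.ker ≤ F := (QuotientGroup.ker_mk' _).trans_le F.normalCore_le
  have : Finite (H ⧸ F.normalCore) := Subgroup.finite_quotient_of_finiteIndex
  have : Group.IsNilpotent (H ⧸ F.normalCore) := (hp.to_quotient _).isNilpotent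
  rcases eq_top_or_exists_le_coatom (F.map π) with htop | ⟨P, hP, hFP⟩
  · rw [← Subgroup.comap_map_eq_self hker, htop, Subgroup.comap_top]
  have hcomm : commutator H ≤ P.comap π := by
    rw [← Subgroup.map_le_iff_le_comap, commutator_def, Subgroup.map_commutator]
    exact (Subgroup.commutator_mono le_top le_top).trans (commutator_le_of_isCoatom hP)
  have hcomap : P.comap π = ⊤ :=
    top_le_iff.1 (hM ▸ sup_le (hMF.trans (Subgroup.map_le_iff_le_comap.1 hFP)) hcomm)
  exact absurd (Subgroup.comap_injective hπ (hcomap.trans (Subgroup.comap_top π).symm)) hP.1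

/-- Every subgroup of finite index in `L` is tame. This property of subgroups, unlike tameness
itself, can be checked on the sections of a self-similar group. -/
def IsHereditarilyTame (L : Subgroup H) : Prop :=
  ∀ K ≤ L, K.relIndex L ≠ 0 → IsTameGroup K

namespace IsHereditarilyTame

theorem of_finite (L : Subgroup H) [Finite L] : IsHereditarilyTame L := fun _ hK _ =>
  have := Finite.of_injective _ (Subgroup.inclusion_injective hK)
  .of_finite

theorem map {L : Subgroup H} (hL : IsHereditarilyTame L) {f : H →* K}
    (hf : Function.Injective f) : IsHereditarilyTame (L.map f) := by
  intro A hA hrel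
  have hle : A.comap f ≤ L :=
    (Subgroup.comap_mono hA).trans_eq (Subgroup.comap_map_eq_self_of_injective hf L)
  have htame := hL _ hle (by rwa [Subgroup.relIndex_comap])
  have hmap := htame.of_mulEquiv ((A.comap f).equivMapOfInjective f hf)
  rwa [Subgroup.map_comap_eq_self (hA.trans (Subgroup.map_le_range f L))] at hmap

end IsHereditarilyTame

end Profinite

theorem finiteIndex_commutator_of_isOfFinOrder {H : Type*} [Group H] [Group.FG H]
    (h : ∀ x : H, IsOfFinOrder x) : (commutator H).FiniteIndex := by
  have hsurj : Function.Surjective (Abelianization.of (G := H)) := QuotientGroup.mk'_surjective _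
  have : Group.FG (Abelianization H) := Group.fg_of_surjective hsurj
  have htorsion : IsMulTorsion (Abelianization H) := hsurj.forall.2 fun y =>
    MonoidHom.isOfFinOrder _ (h y)
  have : Finite (H ⧸ commutator H) :=
    CommGroup.finite_of_fg_isMulTorsion (Abelianization H) htorsion
  exact Subgroup.finiteIndex_of_finite_quotient

/-! ### The wreath recursion -/

namespace GuptaSidki

open scoped commutatorElement

/-- The Gupta–Sidki group as a type. -/
abbrev GSGroup (p : ℕ) : Type := guptaSidkiGroup p

variable {p : ℕ}

section WreathRecursion

/-- The generator `a` as an element of the group. -/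
def genA (p : ℕ) : GSGroup p := ⟨a p, Subgroup.subset_closure (Or.inl rfl)⟩

/-- The generator `b` as an element of the group. -/
def genB (p : ℕ) : GSGroup p := ⟨b p, Subgroup.subset_closure (Or.inr rfl)⟩

theorem closure_generators : Subgroup.closure {genA p, genB p} = ⊤ := by
  have h : Subgroup.closure (Subtype.val ⁻¹' ({a p, b p} : Set (AutTree (ZMod p)))) =
      (⊤ : Subgroup (GSGroup p)) := Subgroup.closure_closure_coe_preimage
  rw [← h]
  congr 1
  ext x
  simp [genA, genB, Subtype.ext_iff]

@[elab_as_elim]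
theorem generators_induction {P : GSGroup p → Prop} (genA : P (genA p)) (genB : P (genB p))
    (one : P 1) (mul : ∀ x y, P x → P y → P (x * y)) (inv : ∀ x, P x → P x⁻¹)
    (g : GSGroup p) : P g :=
  Subgroup.closure_induction (p := fun x _ => P x)
    (by rintro x (rfl | rfl) <;> assumption) one (fun x y _ _ => mul x y) (fun x _ => inv x)
    (closure_generators ▸ Subgroup.mem_top g)

/-- The image of a word under a group element. -/
def act (g : GSGroup p) (w : List (ZMod p)) : List (ZMod p) := (g : AutTree (ZMod p)) w

@[simp] theorem act_mul (g h : GSGroup p) (w) : act (g * h) w = act g (act h w) := rfl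

@[simp] theorem act_one (w) : act (1 : GSGroup p) w = w := rfl

theorem act_inv_act (g : GSGroup p) (w) : act g⁻¹ (act g w) = w := by
  rw [← act_mul, inv_mul_cancel, act_one]

theorem act_act_inv (g : GSGroup p) (w) : act g (act g⁻¹ w) = w := by
  rw [← act_mul, mul_inv_cancel, act_one]

theorem act_ext {g h : GSGroup p} (H : ∀ w, act g w = act h w) : g = h :=
  Subtype.ext (RelIso.ext H)

theorem act_genA_cons (i : ZMod p) (w) : act (genA p) (i :: w) = (i + 1) :: w := rfl

/-- The action of `b` on the subtree at the letter `i`, that is, the entry at `i` of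
`b = (a, a⁻¹, 1, …, 1, b)`. -/
def secB (i : ZMod p) : GSGroup p :=
  if i = 0 then genA p else if i = 1 then (genA p)⁻¹ else if i = -1 then genB p else 1

theorem act_genB_cons (i : ZMod p) (w) : act (genB p) (i :: w) = i :: act (secB i) w := by
  change spinal (a p) (a p)⁻¹ (i :: w) = _
  unfold spinal secB
  split_ifs <;> rfl

theorem act_nil (g : GSGroup p) : act g [] = [] := by
  induction g using generators_induction with
  | genA => rfl
  | genB => rfl
  | one => rfl
  | mul x y hx hy => rw [act_mul, hy, hx]
  | inv x hx => conv_lhs => rw [← hx, act_inv_act]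

theorem exists_act_cons (g : GSGroup p) : ∃ (k : ZMod p) (σ : ZMod p → GSGroup p),
    ∀ i w, act g (i :: w) = (i + k) :: act (σ i) w := by
  induction g using generators_induction with
  | genA => exact ⟨1, fun _ => 1, act_genA_cons⟩
  | genB => exact ⟨0, secB, fun i w => by rw [act_genB_cons, add_zero]⟩
  | one => exact ⟨0, fun _ => 1, fun i w => by simp⟩
  | mul x y hx hy =>
    obtain ⟨k, σ, hx⟩ := hx
    obtain ⟨l, τ, hy⟩ := hy
    exact ⟨l + k, fun i => σ (i + l) * τ i, fun i w => by rw [act_mul, hy, hx, act_mul, add_assoc]⟩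
  | inv x hx =>
    obtain ⟨k, σ, hx⟩ := hx
    refine ⟨-k, fun i => (σ (i - k))⁻¹, fun i w => ?_⟩
    have : act x ((i + -k) :: act (σ (i - k))⁻¹ w) = i :: w := by
      rw [hx, ← sub_eq_add_neg, act_act_inv, sub_add_cancel]
    rw [← this, act_inv_act]

/-- The rotation `k` such that a group element acts on first letters as `i ↦ i + k`. -/
noncomputable def rot (g : GSGroup p) : ZMod p := (exists_act_cons g).choose

/-- The section of a group element at a letter: its action on the subtree at that letter. -/
noncomputable def sec (g : GSGroup p) : ZMod p → GSGroup p :=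
  (exists_act_cons g).choose_spec.choose

theorem act_cons (g : GSGroup p) (i w) : act g (i :: w) = (i + rot g) :: act (sec g i) w :=
  (exists_act_cons g).choose_spec.choose_spec i w

theorem rot_eq_and_sec_eq_of_act_cons {g : GSGroup p} {k : ZMod p} {σ : ZMod p → GSGroup p}
    (h : ∀ i w, act g (i :: w) = (i + k) :: act (σ i) w) : rot g = k ∧ ∀ i, sec g i = σ i := by
  refine ⟨?_, fun i => act_ext fun w => ?_⟩
  · simpa using (List.cons.inj ((act_cons g 0 []).symm.trans (h 0 []))).1
  · exact (List.cons.inj ((act_cons g i w).symm.trans (h i w))).2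

theorem rot_eq_zero_and_sec_genB : rot (genB p) = 0 ∧ ∀ i, sec (genB p) i = secB i :=
  rot_eq_and_sec_eq_of_act_cons fun i w => by rw [act_genB_cons, add_zero]

theorem rot_eq_zero_and_sec_one : rot (1 : GSGroup p) = 0 ∧ ∀ i, sec (1 : GSGroup p) i = 1 :=
  rot_eq_and_sec_eq_of_act_cons fun i w => by simp

theorem rot_eq_add_and_sec_mul (g h : GSGroup p) :
    rot (g * h) = rot h + rot g ∧ ∀ i, sec (g * h) i = sec g (i + rot h) * sec h i :=
  rot_eq_and_sec_eq_of_act_cons fun i w => by rw [act_mul, act_cons, act_cons, act_mul, add_assoc]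

@[simp] theorem rot_genA : rot (genA p) = 1 :=
  (rot_eq_and_sec_eq_of_act_cons (σ := fun _ => 1) act_genA_cons).1

@[simp] theorem sec_genA (i : ZMod p) : sec (genA p) i = 1 :=
  (rot_eq_and_sec_eq_of_act_cons (σ := fun _ => 1) act_genA_cons).2 i

@[simp] theorem rot_genB : rot (genB p) = 0 := rot_eq_zero_and_sec_genB.1

@[simp] theorem sec_genB (i : ZMod p) : sec (genB p) i = secB i := rot_eq_zero_and_sec_genB.2 i

@[simp] theorem rot_one : rot (1 : GSGroup p) = 0 := rot_eq_zero_and_sec_one.1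

@[simp] theorem sec_one (i : ZMod p) : sec (1 : GSGroup p) i = 1 := rot_eq_zero_and_sec_one.2 i

@[simp] theorem rot_mul (g h : GSGroup p) : rot (g * h) = rot g + rot h := by
  rw [(rot_eq_add_and_sec_mul g h).1, add_comm]

@[simp] theorem sec_mul (g h : GSGroup p) (i) : sec (g * h) i = sec g (i + rot h) * sec h i :=
  (rot_eq_add_and_sec_mul g h).2 i

/-- The rotation as a homomorphism. -/
noncomputable def rotHom (p : ℕ) : GSGroup p →* Multiplicative (ZMod p) where
  toFun g := .ofAdd (rot g)
  map_one' := by simp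
  map_mul' g h := by simp

@[simp] theorem rot_inv (g : GSGroup p) : rot g⁻¹ = -rot g :=
  map_inv (rotHom p) g

@[simp] theorem rot_pow (g : GSGroup p) (n : ℕ) : rot (g ^ n) = n * rot g := by
  rw [← nsmul_eq_mul]
  exact map_pow (rotHom p) g n

@[simp] theorem rot_zpow (g : GSGroup p) (n : ℤ) : rot (g ^ n) = n * rot g := by
  rw [← zsmul_eq_mul]
  exact map_zpow (rotHom p) g n

@[simp] theorem sec_inv (g : GSGroup p) (i) : sec g⁻¹ i = (sec g (i - rot g))⁻¹ := by
  have h : sec (g * g⁻¹) i = 1 := by rw [mul_inv_cancel, sec_one]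
  rw [sec_mul, rot_inv, ← sub_eq_add_neg] at h
  exact (inv_eq_of_mul_eq_one_right h).symm

theorem eq_one_of_rot_of_sec {g : GSGroup p} (hr : rot g = 0) (hs : ∀ i, sec g i = 1) : g = 1 := by
  refine act_ext fun w => ?_
  cases w with
  | nil => exact act_nil g
  | cons i w => rw [act_cons, hr, hs, add_zero, act_one, act_one]

@[simp] theorem sec_genA_zpow (n : ℤ) (i : ZMod p) : sec (genA p ^ n) i = 1 := by
  induction n using Int.induction_on generalizing i with
  | zero => simp
  | succ n ih => rw [zpow_add_one, sec_mul, sec_genA, mul_one, ih]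
  | pred n ih => rw [zpow_sub_one, sec_mul, ih, sec_inv, sec_genA, inv_one, one_mul]

theorem genA_pow : genA p ^ p = 1 :=
  eq_one_of_rot_of_sec (by simp) fun i => by simpa using sec_genA_zpow (p : ℤ) i

end WreathRecursion

/-! ### Level stabilizers -/

section LevelStabilizers

/-- The stabilizer of the first level. -/
noncomputable def firstStab (p : ℕ) : Subgroup (GSGroup p) := (rotHom p).ker

@[simp] theorem mem_firstStab {g : GSGroup p} : g ∈ firstStab p ↔ rot g = 0 := Iff.rfl

instance [NeZero p] : (firstStab p).FiniteIndex := inferInstanceAs (rotHom p).ker.FiniteIndex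

/-- The section at a letter as a homomorphism from the stabilizer of the first level. -/
noncomputable def secHom (i : ZMod p) : firstStab p →* GSGroup p where
  toFun g := sec g i
  map_one' := by simp
  map_mul' g h := by rw [Subgroup.coe_mul, sec_mul, mem_firstStab.1 h.2, add_zero]

@[simp] theorem secHom_apply (i : ZMod p) (g : firstStab p) : secHom i g = sec g i := rfl

theorem iInf_ker_secHom : ⨅ i, (secHom (p := p) i).ker = ⊥ := by
  refine (Subgroup.eq_bot_iff_forall _).2 fun g hg => Subtype.ext ?_
  exact eq_one_of_rot_of_sec (mem_firstStab.1 g.2) fun i => Subgroup.mem_iInf.1 hg i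

theorem sec_zpow {g : GSGroup p} (hg : rot g = 0) (n : ℤ) (i) : sec (g ^ n) i = sec g i ^ n :=
  map_zpow (secHom i) ⟨g, hg⟩ n

theorem sec_pow {g : GSGroup p} (hg : rot g = 0) (n : ℕ) (i) : sec (g ^ n) i = sec g i ^ n :=
  map_pow (secHom i) ⟨g, hg⟩ n

/-- The pointwise stabilizers of the levels of the tree. -/
noncomputable def levelStab (p : ℕ) : ℕ → Subgroup (GSGroup p)
  | 0 => ⊤
  | n + 1 => (⨅ i, (levelStab p n).comap (secHom i)).map (firstStab p).subtype

theorem mem_levelStab_succ {n : ℕ} {g : GSGroup p} :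
    g ∈ levelStab p (n + 1) ↔ rot g = 0 ∧ ∀ i, sec g i ∈ levelStab p n := by
  simp [levelStab, Subgroup.mem_iInf, and_comm]

instance [NeZero p] (n : ℕ) : (levelStab p n).FiniteIndex := by
  induction n with
  | zero => exact inferInstanceAs (⊤ : Subgroup _).FiniteIndex
  | succ n ih =>
    have := Subgroup.finiteIndex_iInf fun i => finiteIndex_comap (levelStab p n) (secHom i)
    exact finiteIndex_map_subtype _

theorem iInf_levelStab : ⨅ n, levelStab p n = ⊥ := by
  refine (Subgroup.eq_bot_iff_forall _).2 fun g hg => act_ext fun w => ?_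
  rw [act_one]
  rw [Subgroup.mem_iInf] at hg
  induction w generalizing g with
  | nil => exact act_nil g
  | cons i w ih =>
    rw [act_cons, (mem_levelStab_succ.1 (hg 1)).1, add_zero,
      ih (sec g i) fun n => (mem_levelStab_succ.1 (hg (n + 1))).2 i]

theorem isProfinitelyClosed_bot [NeZero p] : IsProfinitelyClosed (⊥ : Subgroup (GSGroup p)) := by
  intro x hx
  rw [← iInf_levelStab, Subgroup.mem_iInf, not_forall] at hx
  obtain ⟨n, hn⟩ := hx
  exact ⟨levelStab p n, inferInstance, bot_le, hn⟩

end LevelStabilizers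

/-! ### The exponent of `b` -/

theorem sum_comp_add_right {G M : Type*} [AddGroup G] [Fintype G] [AddCommMonoid M] (f : G → M)
    (c : G) : ∑ i, f (i + c) = ∑ i, f i :=
  Equiv.sum_comp (Equiv.addRight c) f

section Exponent

variable [Fact p.Prime]

theorem rot_secB (i : ZMod p) :
    rot (secB i) = (if i = 0 then 1 else 0) - (if i = 1 then 1 else 0) := by
  by_cases h0 : i = 0
  · simp [secB, h0]
  by_cases h1 : i = 1
  · simp [secB, h1]
  unfold secB
  split_ifs <;> simp

theorem sum_rot_sec (g : GSGroup p) : ∑ i, rot (sec g i) = 0 := by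
  induction g using generators_induction with
  | genA => simp
  | genB => simp [rot_secB]
  | one => simp
  | mul x y hx hy =>
    simp only [sec_mul, rot_mul, Finset.sum_add_distrib]
    rw [sum_comp_add_right (fun i => rot (sec x i)), hx, hy, add_zero]
  | inv x hx =>
    simp only [sec_inv, rot_inv, Finset.sum_neg_distrib, sub_eq_add_neg]
    rw [sum_comp_add_right (fun i => rot (sec x i)), hx, neg_zero]

/-- The total exponent of `b` in a group element. It is well defined because it can be read off the
first two levels: the expression on the right is additive in `g`, vanishes at `a` and is `1` at
`b = (a, a⁻¹, 1, …, 1, b)`. -/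
noncomputable def bexp (g : GSGroup p) : ZMod p := -∑ i, i * rot (sec g i)

@[simp] theorem bexp_one : bexp (1 : GSGroup p) = 0 := by simp [bexp]

@[simp] theorem bexp_mul (g h : GSGroup p) : bexp (g * h) = bexp g + bexp h := by
  unfold bexp
  have hshift : ∑ i, i * rot (sec g (i + rot h)) = ∑ i, i * rot (sec g i) := calc
    _ = ∑ i, (i - rot h) * rot (sec g i) := by
      simpa only [add_sub_cancel_right] using
        sum_comp_add_right (fun i => (i - rot h) * rot (sec g i)) (rot h)
    _ = ∑ i, i * rot (sec g i) := by
      simp only [sub_mul, Finset.sum_sub_distrib, ← Finset.mul_sum, sum_rot_sec, mul_zero, sub_zero]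
  simp only [sec_mul, rot_mul, mul_add, Finset.sum_add_distrib]
  rw [hshift, neg_add]

@[simp] theorem bexp_genA : bexp (genA p) = 0 := by simp [bexp]

@[simp] theorem bexp_genB : bexp (genB p) = 1 := by simp [bexp, rot_secB, mul_sub]

/-- The exponent of `b` as a homomorphism. -/
noncomputable def bexpHom (p : ℕ) [Fact p.Prime] : GSGroup p →* Multiplicative (ZMod p) where
  toFun g := .ofAdd (bexp g)
  map_one' := by simp
  map_mul' g h := by simp

@[simp] theorem bexp_inv (g : GSGroup p) : bexp g⁻¹ = -bexp g :=
  map_inv (bexpHom p) g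

@[simp] theorem bexp_zpow (g : GSGroup p) (n : ℤ) : bexp (g ^ n) = n * bexp g := by
  rw [← zsmul_eq_mul]
  exact map_zpow (bexpHom p) g n

end Exponent

section Odd

@[simp] theorem secB_zero : secB (0 : ZMod p) = genA p := by simp [secB]

@[simp] theorem secB_one [Fact p.Prime] : secB (1 : ZMod p) = (genA p)⁻¹ := by simp [secB]

@[simp] theorem secB_neg_one [Fact p.Prime] [Fact (2 < p)] : secB (-1 : ZMod p) = genB p := by
  simp [secB, ZMod.neg_one_ne_one]

theorem secB_of_ne {i : ZMod p} (h0 : i ≠ 0) (h1 : i ≠ 1) (h2 : i ≠ -1) : secB i = 1 := by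
  simp [secB, h0, h1, h2]

variable [Fact p.Prime] [Fact (2 < p)]

@[elab_as_elim]
theorem secB_cases {P : ZMod p → GSGroup p → Prop} (zero : P 0 (genA p)) (one : P 1 (genA p)⁻¹)
    (neg_one : P (-1) (genB p)) (of_ne : ∀ i, i ≠ 0 → i ≠ 1 → i ≠ -1 → P i 1) (i : ZMod p) :
    P i (secB i) := by
  by_cases h0 : i = 0
  · rwa [h0, secB_zero]
  by_cases h1 : i = 1
  · rwa [h1, secB_one]
  by_cases h2 : i = -1
  · rwa [h2, secB_neg_one]
  rw [secB_of_ne h0 h1 h2]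
  exact of_ne i h0 h1 h2

theorem bexp_secB (i : ZMod p) : bexp (secB i) = if i = -1 then 1 else 0 := by
  induction i using secB_cases with
  | zero => simp
  | one => simp [ZMod.neg_one_ne_one.symm]
  | neg_one => simp
  | of_ne i _ _ h2 => simp [h2]

theorem rot_sec (g : GSGroup p) (i : ZMod p) :
    rot (sec g i) = bexp (sec g (i - 1)) - bexp (sec g (i - 2)) := by
  induction g using generators_induction generalizing i with
  | genA => simp
  | genB =>
    simp only [sec_genB, rot_secB, bexp_secB]
    congr 2
    · simp
    · rw [sub_eq_iff_eq_add]; norm_num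
  | one => simp
  | mul x y hx hy =>
    rw [sec_mul, rot_mul, hx, hy, sec_mul, sec_mul, bexp_mul, bexp_mul,
      show i - 1 + rot y = i + rot y - 1 by ring, show i - 2 + rot y = i + rot y - 2 by ring]
    ring
  | inv x hx =>
    rw [sec_inv, rot_inv, hx, sec_inv, sec_inv, bexp_inv, bexp_inv,
      show i - 1 - rot x = i - rot x - 1 by ring, show i - 2 - rot x = i - rot x - 2 by ring]
    ring

theorem sum_bexp_sec (g : GSGroup p) : ∑ i, bexp (sec g i) = bexp g := by
  conv_rhs => unfold bexp
  have hshift (c : ZMod p) :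
      ∑ i, i * bexp (sec g (i - c)) = ∑ i, (i + c) * bexp (sec g i) := by
    simpa only [← sub_eq_add_neg, sub_add_cancel] using
      sum_comp_add_right (fun i => (i + c) * bexp (sec g i)) (-c)
  simp only [rot_sec, mul_sub, Finset.sum_sub_distrib, hshift]
  rw [← Finset.sum_sub_distrib, ← Finset.sum_neg_distrib]
  exact Finset.sum_congr rfl fun i _ => by ring

theorem genB_pow : genB p ^ p = 1 := by
  rw [← Subgroup.mem_bot, ← iInf_levelStab, Subgroup.mem_iInf]
  intro n
  induction n with
  | zero => exact Subgroup.mem_top _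
  | succ n ih =>
    refine mem_levelStab_succ.2 ⟨by simp, fun i => ?_⟩
    rw [sec_pow rot_genB, sec_genB]
    induction i using secB_cases with
    | zero => simp [genA_pow, one_mem]
    | one => simp [genA_pow, one_mem]
    | neg_one => exact ih
    | of_ne => simp [one_mem]

end Odd

theorem zpow_eq_one_of_intCast_eq_zero {H : Type*} [Group H] {x : H} (hx : x ^ p = 1) {k : ℤ}
    (hk : (k : ZMod p) = 0) : x ^ k = 1 := by
  obtain ⟨m, rfl⟩ := (ZMod.intCast_zmod_eq_zero_iff_dvd k p).1 hk
  rw [zpow_mul, zpow_natCast, hx, one_zpow]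

theorem exists_zpow_zpow_eq_self [Fact p.Prime] {H : Type*} [Group H] {x : H} (hx : x ^ p = 1)
    {k : ℤ} (hk : (k : ZMod p) ≠ 0) : ∃ m : ℤ, (x ^ k) ^ m = x := by
  refine ⟨((k : ZMod p)⁻¹.val : ℤ), ?_⟩
  rw [← zpow_mul, ← mul_inv_eq_one, ← zpow_sub_one]
  exact zpow_eq_one_of_intCast_eq_zero hx (by simp [hk])

/-! ### Length -/

/-- `BLengthLE n g` says that `g` is a product of powers of `a` and at most `n` powers of `b`. -/
inductive BLengthLE : ℕ → GSGroup p → Prop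
  | base (k : ℤ) : BLengthLE 0 (genA p ^ k)
  | step {n : ℕ} {g : GSGroup p} (e k : ℤ) :
      BLengthLE n g → BLengthLE (n + 1) (g * genB p ^ e * genA p ^ k)

namespace BLengthLE

theorem one : BLengthLE 0 (1 : GSGroup p) := by simpa using base (p := p) 0

theorem succ {n : ℕ} {g : GSGroup p} (h : BLengthLE n g) : BLengthLE (n + 1) g := by
  simpa using step 0 0 h

theorem mono {n m : ℕ} {g : GSGroup p} (h : BLengthLE n g) (hnm : n ≤ m) : BLengthLE m g :=
  Nat.le_induction h (fun _ _ => succ) m hnm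

theorem mul_genA_zpow {n : ℕ} {g : GSGroup p} (h : BLengthLE n g) (k : ℤ) :
    BLengthLE n (g * genA p ^ k) := by
  cases h with
  | base l => rw [← zpow_add]; exact base _
  | step e l h => rw [mul_assoc, ← zpow_add]; exact step _ _ h

theorem genA_zpow_mul {n : ℕ} {g : GSGroup p} (h : BLengthLE n g) (k : ℤ) :
    BLengthLE n (genA p ^ k * g) := by
  induction h with
  | base l => rw [← zpow_add]; exact base _
  | step e l _ ih => rw [← mul_assoc, ← mul_assoc]; exact step _ _ ih

theorem mul {m n : ℕ} {g h : GSGroup p} (hg : BLengthLE m g) (hh : BLengthLE n h) :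
    BLengthLE (m + n) (g * h) := by
  induction hh with
  | base l => exact hg.mul_genA_zpow l
  | step e l _ ih => rw [← mul_assoc, ← mul_assoc]; exact step _ _ ih

theorem genB_zpow (e : ℤ) : BLengthLE 1 (genB p ^ e) := by simpa using step e 0 (one (p := p))

theorem inv {n : ℕ} {g : GSGroup p} (h : BLengthLE n g) : BLengthLE n g⁻¹ := by
  induction h with
  | base l => rw [← zpow_neg]; exact base _
  | step e l _ ih =>
    rw [mul_inv_rev, mul_inv_rev, ← zpow_neg, ← zpow_neg, add_comm]
    exact ((genB_zpow _).mul ih).genA_zpow_mul _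

theorem exists_of_group (g : GSGroup p) : ∃ n, BLengthLE n g := by
  induction g using generators_induction with
  | genA => exact ⟨0, by simpa using base (p := p) 1⟩
  | genB => exact ⟨1, by simpa using genB_zpow (p := p) 1⟩
  | one => exact ⟨0, one⟩
  | mul x y hx hy =>
    obtain ⟨m, hm⟩ := hx
    obtain ⟨n, hn⟩ := hy
    exact ⟨m + n, hm.mul hn⟩
  | inv x hx =>
    obtain ⟨m, hm⟩ := hx
    exact ⟨m, hm.inv⟩

end BLengthLE

theorem sec_mul_genB_zpow_mul_genA_zpow (g : GSGroup p) (e k : ℤ) (i : ZMod p) :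
    sec (g * genB p ^ e * genA p ^ k) i =
      sec g (i + (k : ZMod p)) * secB (i + (k : ZMod p)) ^ e := by
  simp [sec_zpow]

section OddLength

variable [Fact p.Prime] [Fact (2 < p)]

theorem bLengthLE_secB_zpow (i : ZMod p) (e : ℤ) :
    BLengthLE (if i = -1 then 1 else 0) (secB i ^ e) := by
  induction i using secB_cases with
  | zero => simpa using BLengthLE.base e
  | one => simpa [ZMod.neg_one_ne_one.symm] using BLengthLE.base (-e)
  | neg_one => simpa using BLengthLE.genB_zpow e
  | of_ne i _ _ h2 => simpa [h2] using BLengthLE.one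

theorem BLengthLE.exists_sum_le {n : ℕ} {g : GSGroup p} (h : BLengthLE n g) :
    ∃ ν : ZMod p → ℕ, (∀ i, BLengthLE (ν i) (sec g i)) ∧ ∑ i, ν i ≤ n := by
  induction h with
  | base k => exact ⟨fun _ => 0, fun i => by rw [sec_genA_zpow]; exact one, by simp⟩
  | @step n g e k _ ih =>
    obtain ⟨ν, hν, hsum⟩ := ih
    refine ⟨fun i => ν (i + (k : ZMod p)) + if i + (k : ZMod p) = -1 then 1 else 0, fun i => ?_, ?_⟩
    · rw [sec_mul_genB_zpow_mul_genA_zpow]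
      exact (hν _).mul (bLengthLE_secB_zpow _ e)
    · rw [sum_comp_add_right (fun i => ν i + if i = -1 then 1 else 0), Finset.sum_add_distrib]
      simpa using hsum

/- Two consecutive powers of `b` separated by a nontrivial power of `a` contribute powers of `b` to
sections at different letters, so a given section receives at most every second one. -/
theorem BLengthLE.sec {n : ℕ} {g : GSGroup p} (h : BLengthLE n g) (i : ZMod p) :
    BLengthLE ((n + 1) / 2) (sec g i) := by
  induction n using Nat.strong_induction_on generalizing g i with
  | _ n ih =>
    cases h with
    | base k => rw [sec_genA_zpow]; exact one
    | @step n g f l h =>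
      cases h with
      | base k =>
        rw [sec_mul_genB_zpow_mul_genA_zpow, sec_genA_zpow, one_mul]
        exact (bLengthLE_secB_zpow _ f).mono (by split_ifs <;> simp)
      | @step n g e k h =>
        by_cases hk : (k : ZMod p) = 0
        · rw [zpow_eq_one_of_intCast_eq_zero genA_pow hk, mul_one, mul_assoc g, ← zpow_add]
          exact (ih (n + 1) (Nat.lt_succ_self _) (h.step (e + f) l) i).mono (by omega)
        · rw [sec_mul_genB_zpow_mul_genA_zpow, sec_mul_genB_zpow_mul_genA_zpow]
          refine (((ih n (by omega) h _).mul (bLengthLE_secB_zpow _ e)).mul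
            (bLengthLE_secB_zpow _ f)).mono ?_
          have : ¬ (i + (l : ZMod p) + (k : ZMod p) = -1 ∧ i + (l : ZMod p) = -1) := by
            rintro ⟨h1, h2⟩
            exact hk (by simpa [h2] using h1)
          split_ifs <;> first | omega | tauto

end OddLength

theorem bLengthLE_sec_pow {g : GSGroup p} {ν : ZMod p → ℕ} (h : ∀ i, BLengthLE (ν i) (sec g i))
    (m : ℕ) (i : ZMod p) :
    BLengthLE (∑ k ∈ Finset.range m, ν (i + k * rot g)) (sec (g ^ m) i) := by
  induction m generalizing i with
  | zero => simpa using BLengthLE.one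
  | succ m ih =>
    have hshift (k : ℕ) : i + (k + 1 : ℕ) * rot g = i + rot g + k * rot g := by push_cast; ring
    rw [pow_succ, sec_mul, Finset.sum_range_succ']
    simp only [hshift]
    exact (ih _).mul (by simpa using h i)

theorem map_sec_pow_eq_sum {M : Type*} [AddCommMonoid M] {φ : GSGroup p → M} (h1 : φ 1 = 0)
    (hmul : ∀ x y, φ (x * y) = φ x + φ y) (g : GSGroup p) (m : ℕ) (i : ZMod p) :
    φ (sec (g ^ m) i) = ∑ k ∈ Finset.range m, φ (sec g (i + k * rot g)) := by
  induction m generalizing i with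
  | zero => simp [h1]
  | succ m ih =>
    have hshift (k : ℕ) : i + (k + 1 : ℕ) * rot g = i + rot g + k * rot g := by push_cast; ring
    rw [pow_succ, sec_mul, hmul, ih, Finset.sum_range_succ']
    simp only [hshift, Nat.cast_zero, zero_mul, add_zero]

theorem sum_range_add_mul [Fact p.Prime] {M : Type*} [AddCommMonoid M] (f : ZMod p → M)
    (i : ZMod p) {r : ZMod p} (hr : r ≠ 0) :
    ∑ k ∈ Finset.range p, f (i + k * r) = ∑ j, f j := by
  refine Finset.sum_nbij' (fun k => i + k * r) (fun j => ((j - i) / r).val)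
    (fun k _ => Finset.mem_univ _) (fun j _ => Finset.mem_range.2 (ZMod.val_lt _))
    (fun k hk => ?_) (fun j _ => ?_) (fun k _ => rfl)
  · have : (i + (k : ZMod p) * r - i) / r = k := by field_simp; ring
    rw [this, ZMod.val_cast_of_lt (Finset.mem_range.1 hk)]
  · simp only [ZMod.natCast_val, ZMod.cast_id', id_eq]
    field_simp
    ring

section PthPower

variable [Fact p.Prime] {g : GSGroup p} (hg : rot g ≠ 0) (i : ZMod p)
include hg

theorem rot_sec_pow_self : rot (sec (g ^ p) i) = 0 := by
  rw [map_sec_pow_eq_sum rot_one rot_mul, sum_range_add_mul (fun j => rot (sec g j)) i hg,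
    sum_rot_sec]

theorem bexp_sec_pow_self [Fact (2 < p)] : bexp (sec (g ^ p) i) = bexp g := by
  rw [map_sec_pow_eq_sum bexp_one bexp_mul, sum_range_add_mul (fun j => bexp (sec g j)) i hg,
    sum_bexp_sec]

theorem BLengthLE.sec_pow_self [Fact (2 < p)] {n : ℕ} (hn : BLengthLE n g) :
    BLengthLE n (GuptaSidki.sec (g ^ p) i) := by
  obtain ⟨ν, hν, hsum⟩ := hn.exists_sum_le
  exact (bLengthLE_sec_pow hν p i).mono (by rwa [sum_range_add_mul ν i hg])

end PthPower

/-! ### Torsion -/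

theorem exists_pow_eq_one_of_sec [NeZero p] {g : GSGroup p} (hg : rot g = 0)
    (h : ∀ i, ∃ k : ℕ, sec g i ^ p ^ k = 1) : ∃ k : ℕ, g ^ p ^ k = 1 := by
  choose k hk using h
  refine ⟨∑ i, k i, eq_one_of_rot_of_sec (by simp [hg]) fun i => ?_⟩
  rw [sec_pow hg, ← Finset.add_sum_erase _ _ (Finset.mem_univ i), pow_add, pow_mul, hk, one_pow]

theorem BLengthLE.exists_eq_conj_genB_zpow {g : GSGroup p} (hg : BLengthLE 1 g) (hr : rot g = 0) :
    ∃ l e : ℤ, g = genA p ^ l * genB p ^ e * (genA p ^ l)⁻¹ := by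
  cases hg with
  | step e k hb =>
    cases hb with
    | base l =>
      have hlk : ((l + k : ℤ) : ZMod p) = 0 := by simpa using hr
      have hk : genA p ^ k = (genA p ^ l)⁻¹ := by
        rw [eq_inv_iff_mul_eq_one, ← zpow_add, add_comm]
        exact zpow_eq_one_of_intCast_eq_zero genA_pow hlk
      exact ⟨l, e, by rw [hk]⟩

section Torsion

variable [Fact p.Prime] [Fact (2 < p)]

/- If `g` fixes the first level, its sections are shorter than `g`. Otherwise `g ^ p` fixes the
first level, and its sections fix the first level and are not longer than `g`. -/
theorem BLengthLE.exists_pow_eq_one {n : ℕ} {g : GSGroup p} (hg : BLengthLE n g) :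
    ∃ k : ℕ, g ^ p ^ k = 1 := by
  induction n using Nat.strong_induction_on generalizing g with
  | _ n ih =>
    have of_rot_eq_zero {x : GSGroup p} (hx : BLengthLE n x) (hr : rot x = 0) :
        ∃ k : ℕ, x ^ p ^ k = 1 := by
      rcases lt_or_ge 1 n with hn | hn
      · exact exists_pow_eq_one_of_sec hr fun i => ih _ (by omega) (hx.sec i)
      · obtain ⟨l, e, rfl⟩ := (hx.mono hn).exists_eq_conj_genB_zpow hr
        refine ⟨1, ?_⟩
        rw [pow_one, conj_pow, ← zpow_natCast, zpow_comm, zpow_natCast, genB_pow, one_zpow,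
          mul_one, mul_inv_cancel]
    by_cases hr : rot g = 0
    · exact of_rot_eq_zero hg hr
    · obtain ⟨k, hk⟩ : ∃ k : ℕ, (g ^ p) ^ p ^ k = 1 := exists_pow_eq_one_of_sec (by simp)
        fun i => of_rot_eq_zero (hg.sec_pow_self hr i) (rot_sec_pow_self hr i)
      exact ⟨k + 1, by rw [pow_succ', pow_mul, hk]⟩

theorem isPGroup : IsPGroup p (GSGroup p) := fun g =>
  let ⟨_, hn⟩ := BLengthLE.exists_of_group g
  hn.exists_pow_eq_one

end Torsion

/-! ### Sections of subgroups -/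

section SectionsOfSubgroups

/-- The subgroup of the sections at the letter `i` of the elements of `M` that fix the first
level. -/
noncomputable def secSub (M : Subgroup (GSGroup p)) (i : ZMod p) : Subgroup (GSGroup p) :=
  (M.subgroupOf (firstStab p)).map (secHom i)

theorem mem_secSub {M : Subgroup (GSGroup p)} {i : ZMod p} {x : GSGroup p} :
    x ∈ secSub M i ↔ ∃ g ∈ M, rot g = 0 ∧ sec g i = x := by
  simp [secSub, Subgroup.mem_map, Subgroup.mem_subgroupOf, and_left_comm]

theorem sec_commutatorElement {x y : GSGroup p} (hx : rot x = 0) (hy : rot y = 0) (i : ZMod p) :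
    sec ⁅x, y⁆ i = ⁅sec x i, sec y i⁆ := by
  simp [commutatorElement_def, hx, hy]

theorem rot_commutatorElement (x y : GSGroup p) : rot ⁅x, y⁆ = 0 := by
  simp [commutatorElement_def]

/-- `IsAt i x y` says that `y` acts as `x` on the subtree at the letter `i` and trivially
elsewhere. -/
structure IsAt (i : ZMod p) (x y : GSGroup p) : Prop where
  rot_eq_zero : rot y = 0
  sec_self : sec y i = x
  sec_of_ne : ∀ j, j ≠ i → sec y j = 1

/-- The elements that belong to `N` when they are made to act on the subtree at the letter `i`
only, that is, the section at `i` of the rigid stabilizer of `i` in `N`. -/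
noncomputable def ristSub (N : Subgroup (GSGroup p)) (i : ZMod p) : Subgroup (GSGroup p) :=
  (N.subgroupOf (firstStab p) ⊓ ⨅ j ≠ i, (secHom j).ker).map (secHom i)

theorem mem_ristSub {N : Subgroup (GSGroup p)} {i : ZMod p} {x : GSGroup p} :
    x ∈ ristSub N i ↔ ∃ y ∈ N, IsAt i x y := by
  constructor
  · rintro ⟨y, ⟨hyN, hy⟩, rfl⟩
    have hker : y ∈ ⨅ j ≠ i, (secHom j).ker := hy
    simp only [Subgroup.mem_iInf, MonoidHom.mem_ker, secHom_apply] at hker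
    exact ⟨y, hyN, mem_firstStab.1 y.2, rfl, hker⟩
  · rintro ⟨y, hyN, hr, hi, hj⟩
    refine ⟨⟨y, hr⟩, ⟨hyN, ?_⟩, hi⟩
    simpa [Subgroup.mem_iInf, MonoidHom.mem_ker] using hj

theorem IsAt.conj {i : ZMod p} {x y : GSGroup p} (h : IsAt i x y) (g : GSGroup p) :
    IsAt (i + rot g) (sec g i * x * (sec g i)⁻¹) (g * y * g⁻¹) := by
  refine ⟨by simp [h.rot_eq_zero], by simp [h.rot_eq_zero, h.sec_self], fun j hj => ?_⟩
  have hne : j - rot g ≠ i := fun h => hj (by rw [← h, sub_add_cancel])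
  simp [h.rot_eq_zero, h.sec_of_ne _ hne, ← sub_eq_add_neg]

theorem IsAt.commutatorElement_left {i : ZMod p} {y Y : GSGroup p} (h : IsAt i y Y)
    {Z : GSGroup p} (hZ : rot Z = 0) : IsAt i ⁅sec Z i, y⁆ ⁅Z, Y⁆ where
  rot_eq_zero := rot_commutatorElement Z Y
  sec_self := by rw [sec_commutatorElement hZ h.rot_eq_zero, h.sec_self]
  sec_of_ne j hj := by
    rw [sec_commutatorElement hZ h.rot_eq_zero, h.sec_of_ne j hj, commutatorElement_one_right]

theorem IsAt.sec_commutatorElement_of_rot_ne_zero {i : ZMod p} {x X : GSGroup p} (h : IsAt i x X)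
    {g : GSGroup p} (hg : rot g ≠ 0) : sec ⁅g, X⁆ i = x⁻¹ := by
  have hne : i - rot g ≠ i := by simpa using hg
  simp [commutatorElement_def, h.rot_eq_zero, h.sec_self, h.sec_of_ne _ hne, ← sub_eq_add_neg]

theorem mem_of_forall_sec_mem_ristSub [NeZero p] {N : Subgroup (GSGroup p)} {g : GSGroup p}
    (hg : rot g = 0) (hsec : ∀ j, sec g j ∈ ristSub N j) : g ∈ N := by
  suffices h : ∀ s : Finset (ZMod p), ∀ g : GSGroup p, rot g = 0 → (∀ j, sec g j ∈ ristSub N j) →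
      (∀ j ∉ s, sec g j = 1) → g ∈ N from
    h Finset.univ g hg hsec fun j hj => absurd (Finset.mem_univ j) hj
  intro s
  induction s using Finset.induction_on with
  | empty =>
    intro g hg _ htriv
    rw [eq_one_of_rot_of_sec hg fun j => htriv j (Finset.notMem_empty j)]
    exact N.one_mem
  | insert i s _ ih =>
    intro g hg hsec htriv
    obtain ⟨y, hy, hyi⟩ := mem_ristSub.1 (hsec i)
    have hself : sec (y⁻¹ * g) i = 1 := by simp [hg, hyi.rot_eq_zero, hyi.sec_self]
    have hne (j) (hj : j ≠ i) : sec (y⁻¹ * g) j = sec g j := by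
      simp [hg, hyi.rot_eq_zero, hyi.sec_of_ne j hj]
    refine (Subgroup.mul_mem_cancel_left N (N.inv_mem hy)).1 (ih _ ?_ (fun j => ?_) fun j hj => ?_)
    · simp [hg, hyi.rot_eq_zero]
    · rcases eq_or_ne j i with rfl | hj
      · exact hself ▸ one_mem _
      · exact (hne j hj).symm ▸ hsec j
    · rcases eq_or_ne j i with rfl | hji
      · exact hself
      · exact (hne j hji).trans (htriv j (by simp [hji, hj]))

end SectionsOfSubgroups

section FiniteIndex

variable [NeZero p] (N : Subgroup (GSGroup p)) [N.Normal]

theorem ristSub_le_ristSub (i j : ZMod p) : ristSub N i ≤ ristSub N j := by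
  intro x hx
  obtain ⟨y, hy, hxy⟩ := mem_ristSub.1 hx
  refine mem_ristSub.2 ⟨_, Subgroup.Normal.conj_mem ‹_› y hy (genA p ^ ((j - i).val : ℤ)), ?_⟩
  simpa using hxy.conj (genA p ^ ((j - i).val : ℤ))

theorem finiteIndex_of_ristSub (i : ZMod p) [(ristSub N i).FiniteIndex] : N.FiniteIndex := by
  have hfin (j) : ((ristSub N j).comap (secHom j)).FiniteIndex :=
    have := Subgroup.finiteIndex_of_le (ristSub_le_ristSub N i j)
    finiteIndex_comap _ _
  have := Subgroup.finiteIndex_iInf hfin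
  have := finiteIndex_map_subtype (⨅ j, (ristSub N j).comap (secHom j))
  refine Subgroup.finiteIndex_of_le
    (H := (⨅ j, (ristSub N j).comap (secHom j)).map (firstStab p).subtype) ?_
  rintro _ ⟨g, hg, rfl⟩
  exact mem_of_forall_sec_mem_ristSub (mem_firstStab.1 g.2) fun j => Subgroup.mem_iInf.1 hg j

end FiniteIndex

section Conjugates

variable [NeZero p]

/-- The conjugate `aᵏ b a⁻ᵏ` of `b`. -/
def conjB (k : ZMod p) : GSGroup p :=
  genA p ^ (k.val : ℤ) * genB p * genA p ^ (-(k.val : ℤ))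

@[simp] theorem rot_conjB (k : ZMod p) : rot (conjB k) = 0 := by
  simp [conjB]

@[simp] theorem sec_conjB (k i : ZMod p) : sec (conjB k) i = secB (i - k) := by
  unfold conjB
  rw [sec_mul, sec_mul, sec_genA_zpow, sec_genA_zpow, one_mul, mul_one, rot_zpow, rot_genA]
  simp [sub_eq_add_neg]

end Conjugates

section OddSections

variable [Fact p.Prime] [Fact (2 < p)]

theorem secHom_surjective (i : ZMod p) : Function.Surjective (secHom (p := p) i) := by
  rw [← MonoidHom.range_eq_top, eq_top_iff, ← closure_generators, Subgroup.closure_le]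
  rintro x (rfl | rfl)
  · exact ⟨⟨conjB i, rot_conjB i⟩, by simp⟩
  · exact ⟨⟨conjB (i + 1), rot_conjB _⟩, by simp⟩

theorem exists_sec_eq (i : ZMod p) (x : GSGroup p) : ∃ g, rot g = 0 ∧ sec g i = x := by
  obtain ⟨g, hg⟩ := secHom_surjective i x
  exact ⟨g, g.2, hg⟩

instance ristSub_normal (N : Subgroup (GSGroup p)) [N.Normal] (i : ZMod p) :
    (ristSub N i).Normal where
  conj_mem x hx g := by
    obtain ⟨y, hy, hxy⟩ := mem_ristSub.1 hx
    obtain ⟨Y, hY, rfl⟩ := exists_sec_eq i g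
    refine mem_ristSub.2 ⟨Y * y * Y⁻¹, Subgroup.Normal.conj_mem ‹_› y hy Y, ?_⟩
    simpa [hY] using hxy.conj Y

end OddSections

/-! ### The commutator subgroup -/

theorem commutator_le_of_commute {N : Subgroup (GSGroup p)} [N.Normal]
    (h : Commute (QuotientGroup.mk' N (genA p)) (QuotientGroup.mk' N (genB p))) :
    commutator (GSGroup p) ≤ N := by
  set π := QuotientGroup.mk' N
  have htop : Subgroup.closure {π (genA p), π (genB p)} = ⊤ := by
    rw [← Set.image_pair, ← MonoidHom.map_closure, closure_generators,
      ← MonoidHom.range_eq_map, MonoidHom.range_eq_top]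
    exact QuotientGroup.mk'_surjective N
  have hcomm : ∀ x ∈ ({π (genA p), π (genB p)} : Set _), ∀ y ∈ ({π (genA p), π (genB p)} : Set _),
      x * y = y * x := by
    rintro _ (rfl | rfl) _ (rfl | rfl)
    exacts [rfl, h.eq, h.symm.eq, rfl]
  have hmul (x y : GSGroup p ⧸ N) : Commute x y := by
    have hx : x ∈ Subgroup.closure {π (genA p), π (genB p)} := htop ▸ Subgroup.mem_top x
    have hy : y ∈ Subgroup.closure {π (genA p), π (genB p)} := htop ▸ Subgroup.mem_top y
    have := Subgroup.isMulCommutative_closure hcomm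
    exact congr_arg Subtype.val (mul_comm' (⟨x, hx⟩ : Subgroup.closure _) ⟨y, hy⟩)
  rw [commutator_def, Subgroup.commutator_le]
  intro x _ y _
  rw [← QuotientGroup.eq_one_iff, ← QuotientGroup.mk'_apply, map_commutatorElement,
    commutatorElement_eq_one_iff_commute]
  exact hmul _ _

instance : Group.FG (GSGroup p) :=
  Group.fg_iff.2 ⟨{genA p, genB p}, closure_generators, Set.toFinite _⟩

section CommutatorSubgroup

variable [Fact p.Prime]

theorem exists_abelianization_of_eq (g : GSGroup p) : ∃ i j : ℤ,
    Abelianization.of g = Abelianization.of (genA p) ^ i * Abelianization.of (genB p) ^ j ∧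
      (i : ZMod p) = rot g ∧ (j : ZMod p) = bexp g := by
  induction g using generators_induction with
  | genA => exact ⟨1, 0, by simp⟩
  | genB => exact ⟨0, 1, by simp⟩
  | one => exact ⟨0, 0, by simp⟩
  | mul x y hx hy =>
    obtain ⟨i, j, hx, hi, hj⟩ := hx
    obtain ⟨k, l, hy, hk, hl⟩ := hy
    refine ⟨i + k, j + l, ?_, by simp [hi, hk], by simp [hj, hl]⟩
    rw [map_mul, hx, hy, zpow_add, zpow_add]
    exact mul_mul_mul_comm _ _ _ _
  | inv x hx =>
    obtain ⟨i, j, hx, hi, hj⟩ := hx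
    refine ⟨-i, -j, ?_, by simp [hi], by simp [hj]⟩
    rw [map_inv, hx, zpow_neg, zpow_neg, mul_inv]

variable [Fact (2 < p)]

theorem mem_commutator_of_rot_of_bexp {g : GSGroup p} (hr : rot g = 0) (hb : bexp g = 0) :
    g ∈ commutator (GSGroup p) := by
  obtain ⟨i, j, hg, hi, hj⟩ := exists_abelianization_of_eq g
  rw [← map_zpow, ← map_zpow, zpow_eq_one_of_intCast_eq_zero genA_pow (hi.trans hr),
    zpow_eq_one_of_intCast_eq_zero genB_pow (hj.trans hb), map_one, one_mul] at hg
  exact (QuotientGroup.eq_one_iff _).1 hg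

theorem two_ne_zero_zmod : (2 : ZMod p) ≠ 0 := fun h =>
  ZMod.neg_one_ne_one (n := p) (by linear_combination -h)

/- With `X = b · (a b a⁻¹)` and `Y = (a b a⁻¹) · (a² b a⁻²)`, the sections of `X` and of `Y` at `i`
are both nontrivial for `i = 0` only. -/
theorem commutatorElement_mem_ristSub :
    ⁅genA p * genB p, genB p * secB (-2)⁆ ∈ ristSub (commutator (GSGroup p)) 0 := by
  set X : GSGroup p := conjB 0 * conjB 1
  set Y : GSGroup p := conjB 1 * conjB 2
  have hX : rot X = 0 := by simp [X]
  have hY : rot Y = 0 := by simp [Y]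
  have hXs (i) : sec X i = secB i * secB (i - 1) := by simp [X]
  have hYs (i) : sec Y i = secB (i - 1) * secB (i - 2) := by simp [Y]
  have htriv (i) (hi : i ≠ 0) : sec X i = 1 ∨ sec Y i = 1 := by
    rw [hXs, hYs]
    by_cases h1 : i = 1
    · simp [h1]
    by_cases h2 : i = 2
    · have h21 : (2 : ZMod p) - 1 = 1 := by norm_num
      simp [h2, h21]
    have h4 : (4 : ZMod p) ≠ 0 := by
      have := pow_ne_zero 2 (two_ne_zero_zmod (p := p))
      norm_num at this ⊢
      exact this
    have hpred : secB (i - 1) = 1 := secB_of_ne (sub_ne_zero.2 h1)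
      (fun h => h2 (by linear_combination h)) (fun h => hi (by linear_combination h))
    rw [hpred, mul_one, one_mul]
    rcases eq_or_ne i (-1) with hm | hm
    · exact .inr (secB_of_ne (sub_ne_zero.2 h2) (fun h => h4 (by linear_combination hm - h))
        (fun h => h1 (by linear_combination h)))
    · exact .inl (secB_of_ne hi h1 hm)
  refine mem_ristSub.2 ⟨⁅X, Y⁆, Subgroup.commutator_mem_commutator trivial trivial,
    rot_commutatorElement X Y, ?_, fun i hi => ?_⟩
  · rw [sec_commutatorElement hX hY, hXs, hYs]
    simp
  · rw [sec_commutatorElement hX hY]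
    rcases htriv i hi with h | h <;> simp [h]

theorem commute_map_genA_map_genB {Q : Type*} [Group Q] {π : GSGroup p →* Q}
    (h : Commute (π (genA p * genB p)) (π (genB p * secB (-2)))) :
    Commute (π (genA p)) (π (genB p)) := by
  suffices hmul : Commute (π (genA p * genB p)) (π (genB p)) by
    simpa using hmul.mul_left (Commute.refl (π (genB p))).inv_left
  by_cases h3 : (3 : ZMod p) = 0
  · have hm2 : (-2 : ZMod p) = 1 := by linear_combination -h3
    have hsq : Commute (π (genA p * genB p)) (π (genB p) ^ 2) := by
      simpa [hm2, mul_assoc, pow_two] using h.mul_right (Commute.refl _)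
    obtain ⟨m, hm⟩ : p ∣ 3 := (ZMod.natCast_eq_zero_iff 3 p).1 (by exact_mod_cast h3)
    have hfourth : (π (genB p) ^ 2) ^ 2 = π (genB p) := by
      rw [← pow_mul, show 2 * 2 = 3 + 1 from rfl, pow_succ, hm, pow_mul, ← map_pow, genB_pow,
        map_one, one_pow, one_mul]
    exact hfourth ▸ hsq.pow_right 2
  · rwa [secB_of_ne (neg_ne_zero.2 two_ne_zero_zmod) (fun h => h3 (by linear_combination -h))
      (fun h => one_ne_zero (α := ZMod p) (by linear_combination -h)), mul_one] at h

theorem commutator_le_ristSub (i : ZMod p) :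
    commutator (GSGroup p) ≤ ristSub (commutator (GSGroup p)) i := by
  refine le_trans (commutator_le_of_commute (commute_map_genA_map_genB ?_))
    (ristSub_le_ristSub _ 0 i)
  rw [← commutatorElement_eq_one_iff_commute, ← map_commutatorElement, QuotientGroup.mk'_apply,
    QuotientGroup.eq_one_iff]
  exact commutatorElement_mem_ristSub

theorem exists_mem_commutator_isAt (i : ZMod p) {x : GSGroup p} (hx : x ∈ commutator (GSGroup p)) :
    ∃ y ∈ commutator (GSGroup p), IsAt i x y := mem_ristSub.1 (commutator_le_ristSub i hx)

theorem isOfFinOrder (g : GSGroup p) : IsOfFinOrder g := by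
  obtain ⟨k, hk⟩ := isPGroup g
  exact isOfFinOrder_iff_pow_eq_one.2 ⟨p ^ k, pow_pos (Fact.out : p.Prime).pos _, hk⟩

instance : (commutator (GSGroup p)).FiniteIndex :=
  finiteIndex_commutator_of_isOfFinOrder isOfFinOrder

instance finiteIndex_commutator_commutator :
    ⁅commutator (GSGroup p), commutator (GSGroup p)⁆.FiniteIndex := by
  have := finiteIndex_commutator_of_isOfFinOrder fun x : commutator (GSGroup p) =>
    Submonoid.isOfFinOrder_coe.1 (isOfFinOrder (x : GSGroup p))
  have := finiteIndex_map_subtype (commutator (commutator (GSGroup p)))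
  rwa [commutator_def (commutator (GSGroup p)), Subgroup.map_commutator, ← MonoidHom.range_eq_map,
    Subgroup.range_subtype] at this

/-! ### Just infiniteness -/

theorem finiteIndex_of_rot_ne_zero {g : GSGroup p} (hg : rot g ≠ 0) {N : Subgroup (GSGroup p)}
    [N.Normal] (h : ∀ x ∈ commutator (GSGroup p), ∀ y ∈ commutator (GSGroup p), ⁅⁅g, x⁆, y⁆ ∈ N) :
    N.FiniteIndex := by
  have hle : ⁅commutator (GSGroup p), commutator (GSGroup p)⁆ ≤ ristSub N 0 := by
    refine Subgroup.commutator_le.2 fun x hx y hy => ?_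
    obtain ⟨X, hX, hXat⟩ := exists_mem_commutator_isAt 0 (inv_mem hx)
    obtain ⟨Y, hY, hYat⟩ := exists_mem_commutator_isAt 0 hy
    have hsec : sec ⁅g, X⁆ 0 = x := by rw [hXat.sec_commutatorElement_of_rot_ne_zero hg, inv_inv]
    refine mem_ristSub.2 ⟨_, h X hX Y hY, ?_⟩
    simpa only [hsec] using hYat.commutatorElement_left (rot_commutatorElement g X)
  have := Subgroup.finiteIndex_of_le hle
  exact finiteIndex_of_ristSub N 0

theorem finiteIndex_of_notMem_levelStab (n : ℕ) {g : GSGroup p} (hg : g ∉ levelStab p n)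
    {N : Subgroup (GSGroup p)} [N.Normal]
    (h : ∀ x ∈ commutator (GSGroup p), ∀ y ∈ commutator (GSGroup p), ⁅⁅g, x⁆, y⁆ ∈ N) :
    N.FiniteIndex := by
  induction n generalizing g N with
  | zero => exact absurd (Subgroup.mem_top g) hg
  | succ n ih =>
    by_cases hr : rot g = 0
    · obtain ⟨i, hi⟩ : ∃ i, sec g i ∉ levelStab p n := by
        simpa [mem_levelStab_succ, hr] using hg
      have := ih hi (N := ristSub N i) fun x hx y hy => by
        obtain ⟨X, hX, hXat⟩ := exists_mem_commutator_isAt i hx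
        obtain ⟨Y, hY, hYat⟩ := exists_mem_commutator_isAt i hy
        refine mem_ristSub.2 ⟨_, h X hX Y hY, ?_⟩
        simpa only [(hXat.commutatorElement_left hr).sec_self] using
          hYat.commutatorElement_left (rot_commutatorElement g X)
      exact finiteIndex_of_ristSub N i
    · exact finiteIndex_of_rot_ne_zero hr h

theorem finiteIndex_of_ne_bot {N : Subgroup (GSGroup p)} [N.Normal] (hN : N ≠ ⊥) :
    N.FiniteIndex := by
  obtain ⟨⟨g, hg⟩, hne⟩ := Subgroup.ne_bot_iff_exists_ne_one.1 hN
  obtain ⟨n, hn⟩ : ∃ n, g ∉ levelStab p n := by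
    rwa [← not_forall, ← Subgroup.mem_iInf, iInf_levelStab, Subgroup.mem_bot,
      ← Subgroup.mk_eq_one (h := hg)]
  refine finiteIndex_of_notMem_levelStab n hn fun x _ y _ => ?_
  have mem_left {z : GSGroup p} (hz : z ∈ N) (w) : ⁅z, w⁆ ∈ N :=
    Subgroup.commutator_le_left N ⊤ (Subgroup.commutator_mem_commutator hz trivial)
  exact mem_left (mem_left hg x) y

theorem hasResiduallyFiniteQuotients_bot :
    HasResiduallyFiniteQuotients (⊥ : Subgroup (GSGroup p)) := by
  intro C _ _
  rcases eq_or_ne C ⊥ with rfl | hC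
  · exact isProfinitelyClosed_bot
  · have := finiteIndex_of_ne_bot hC
    exact .of_finiteIndex C

end CommutatorSubgroup

/-! ### Dense subgroups -/

theorem conj_mem_secSub {M : Subgroup (GSGroup p)} {g x : GSGroup p} {i : ZMod p}
    (hg : g ∈ Subgroup.normalizer (M : Set (GSGroup p))) (hx : x ∈ secSub M i) :
    sec g i * x * (sec g i)⁻¹ ∈ secSub M (i + rot g) := by
  obtain ⟨y, hy, hr, rfl⟩ := mem_secSub.1 hx
  exact mem_secSub.2
    ⟨g * y * g⁻¹, (Subgroup.mem_normalizer_iff.1 hg y).1 hy, by simp [hr], by simp [hr]⟩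

theorem secSub_le_secSub_of_genA_mem [NeZero p] {M : Subgroup (GSGroup p)}
    (hA : genA p ∈ Subgroup.normalizer (M : Set (GSGroup p))) (i j : ZMod p) :
    secSub M i ≤ secSub M j := fun x hx => by
  simpa using conj_mem_secSub (zpow_mem hA ((j - i).val : ℤ)) hx

theorem sec_conj_genB_mem_secSub {M : Subgroup (GSGroup p)} {g : GSGroup p}
    (hg : g * genB p * g⁻¹ ∈ M) (i : ZMod p) :
    sec g i * secB i * (sec g i)⁻¹ ∈ secSub M (i + rot g) :=
  mem_secSub.2 ⟨_, hg, by simp, by simp⟩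

section Prime

variable [Fact p.Prime] {M : Subgroup (GSGroup p)}

theorem exists_rot_eq {g : GSGroup p} (hg : g ∈ M) (hr : rot g ≠ 0) (c : ZMod p) :
    ∃ t ∈ M, rot t = c :=
  ⟨g ^ (c / rot g).val, M.pow_mem hg _, by
    rw [rot_pow, ZMod.natCast_zmod_val, div_mul_cancel₀ _ hr]⟩

theorem exists_rot_ne_zero (hM : IsProfinitelyDense M) : ∃ g ∈ M, rot g ≠ 0 := by
  by_contra! h
  have hA : genA p ∈ firstStab p := hM (firstStab p) h inferInstance ▸ Subgroup.mem_top _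
  exact one_ne_zero (rot_genA.symm.trans (mem_firstStab.1 hA))

theorem exists_rot_eq_zero_and_bexp_ne_zero (hM : IsProfinitelyDense M) :
    ∃ y ∈ M, rot y = 0 ∧ bexp y ≠ 0 := by
  by_contra! h
  have := finiteIndex_comap (bexpHom p).ker (firstStab p).subtype
  have htop := hM.subgroupOf (firstStab p) ((bexpHom p).ker.comap (firstStab p).subtype)
    (fun x hx => h x hx x.2) this
  have hB : (⟨genB p, rot_genB⟩ : firstStab p) ∈ (bexpHom p).ker.comap (firstStab p).subtype :=
    htop ▸ Subgroup.mem_top _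
  exact one_ne_zero (bexp_genB.symm.trans hB)

end Prime

section OddDense

variable [Fact p.Prime] [Fact (2 < p)] {M : Subgroup (GSGroup p)}

theorem isProfinitelyDense_secSub (hM : IsProfinitelyDense M) (i : ZMod p) :
    IsProfinitelyDense (secSub M i) :=
  (hM.subgroupOf (firstStab p)).map (secHom_surjective i)

theorem eq_top_of_forall_secSub_eq_top (hM : IsProfinitelyDense M) (h : ∀ i, secSub M i = ⊤) :
    M = ⊤ := by
  have hsup (i) : M.subgroupOf (firstStab p) ⊔ (secHom i).ker = ⊤ := by
    rw [← Subgroup.comap_map_eq]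
    exact (congrArg _ (h i)).trans (Subgroup.comap_top _)
  have htop := HasResiduallyFiniteQuotients.sup_finset_inf_eq_top (fun i => inferInstance)
    (fun i => hasResiduallyFiniteQuotients_bot.ker (secHom_surjective i))
    (hM.subgroupOf (firstStab p)) hsup Finset.univ
  rw [Finset.inf_univ_eq_iInf, iInf_ker_secHom, sup_bot_eq, Subgroup.subgroupOf_eq_top] at htop
  have := Subgroup.finiteIndex_of_le htop
  exact hM.eq_top_of_finiteIndex

theorem eq_top_of_secSub_eq_top (hM : IsProfinitelyDense M) {i : ZMod p} (h : secSub M i = ⊤) :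
    M = ⊤ := by
  obtain ⟨g, hg, hr⟩ := exists_rot_ne_zero hM
  refine eq_top_of_forall_secSub_eq_top hM fun j => eq_top_iff.2 fun x _ => ?_
  obtain ⟨t, ht, htr⟩ := exists_rot_eq hg hr (j - i)
  have hx : (sec t i)⁻¹ * x * sec t i ∈ secSub M i := h ▸ Subgroup.mem_top _
  simpa [htr, mul_assoc] using conj_mem_secSub (Subgroup.le_normalizer ht) hx

/- The lengths of the sections at `0`, `1` and `-1` add up to at most `n + 1`, and the last factor
`b ^ e` contributes to a section other than the one at `-1`. -/
theorem BLengthLE.exists_sec_inv_mul_sec {n : ℕ} {g : GSGroup p} (hg : BLengthLE n g) (e : ℤ)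
    {k : ℤ} (hk : (k : ZMod p) ≠ 0) : ∃ i : ZMod p, (i = 0 ∨ i = 1) ∧
      BLengthLE n ((GuptaSidki.sec (g * genB p ^ e * genA p ^ k) i)⁻¹ *
        GuptaSidki.sec (g * genB p ^ e * genA p ^ k) (-1)) := by
  obtain ⟨ν, hν, hsum⟩ := hg.exists_sum_le
  set μ : ZMod p → ℕ := fun i => ν (i + (k : ZMod p)) + if i + (k : ZMod p) = -1 then 1 else 0
  have hμ (i) : BLengthLE (μ i) (GuptaSidki.sec (g * genB p ^ e * genA p ^ k) i) := by
    rw [sec_mul_genB_zpow_mul_genA_zpow]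
    exact (hν _).mul (bLengthLE_secB_zpow _ e)
  have hμsum : ∑ i, μ i ≤ n + 1 := by
    rw [sum_comp_add_right (fun i => ν i + if i = -1 then 1 else 0), Finset.sum_add_distrib]
    simpa using hsum
  have hμ_neg_one : μ (-1) ≤ n := by
    have hne : (-1 : ZMod p) + k ≠ -1 := by simpa using hk
    simp only [μ, if_neg hne, add_zero]
    exact (Finset.single_le_sum (fun _ _ => Nat.zero_le _) (Finset.mem_univ _)).trans hsum
  have hμ_three : μ 0 + (μ 1 + μ (-1)) ≤ n + 1 := by
    have hle := Finset.sum_le_sum_of_subset (f := μ)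
      (Finset.subset_univ ({0, 1, -1} : Finset (ZMod p)))
    rw [Finset.sum_insert (by simp), Finset.sum_insert (by simp [ZMod.neg_one_ne_one.symm]),
      Finset.sum_singleton] at hle
    exact hle.trans hμsum
  by_cases h : μ 0 + μ (-1) ≤ n
  · exact ⟨0, .inl rfl, ((hμ 0).inv.mul (hμ (-1))).mono h⟩
  · exact ⟨1, .inr rfl, ((hμ 1).inv.mul (hμ (-1))).mono (by omega)⟩

theorem eq_top_of_comap_conj_eq_top {H : Type*} [Group H] {L : Subgroup H} {s : H}
    (h : L.comap (MulAut.conj s).toMonoidHom = ⊤) : L = ⊤ :=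
  Subgroup.comap_injective (MulAut.conj s).surjective (h.trans (Subgroup.comap_top _).symm)

theorem eq_top_of_genA_mem (hM : IsProfinitelyDense M) {n : ℕ} {w : GSGroup p}
    (hA : genA p ∈ M) (hw : w * genB p * w⁻¹ ∈ M) (hn : BLengthLE n w) : M = ⊤ := by
  induction n generalizing M w with
  | zero =>
    cases hn with
    | base k =>
      have hB := M.mul_mem (M.mul_mem (M.zpow_mem hA (-k)) hw) (M.zpow_mem hA k)
      rw [eq_top_iff, ← closure_generators, Subgroup.closure_le]
      rintro _ (rfl | rfl)
      · exact hA
      · simpa [mul_assoc] using hB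
  | succ n ih =>
    cases hn with
    | @step _ g e k hg =>
      by_cases hk : (k : ZMod p) = 0
      · rw [zpow_eq_one_of_intCast_eq_zero genA_pow hk] at hw
        have hconj : g * genB p ^ e * 1 * genB p * (g * genB p ^ e * 1)⁻¹ = g * genB p * g⁻¹ := by
          group
        exact ih hM hA (hconj ▸ hw) hg
      obtain ⟨i, hi, hlen⟩ := hg.exists_sec_inv_mul_sec e hk
      generalize g * genB p ^ e * genA p ^ k = w at hw hlen
      have hsec (j) : sec w j * secB j * (sec w j)⁻¹ ∈ secSub M 0 :=
        secSub_le_secSub_of_genA_mem (Subgroup.le_normalizer hA) _ _ (sec_conj_genB_mem_secSub hw j)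
      have hA' : sec w i * genA p * (sec w i)⁻¹ ∈ secSub M 0 := by
        rcases hi with rfl | rfl
        · simpa using hsec 0
        · simpa [mul_assoc] using inv_mem (hsec 1)
      have hB' : sec w (-1) * genB p * (sec w (-1))⁻¹ ∈ secSub M 0 := by simpa using hsec (-1)
      refine eq_top_of_secSub_eq_top hM (eq_top_of_comap_conj_eq_top (s := sec w i)
        (ih ((isProfinitelyDense_secSub hM 0).comap (MulAut.conj _).surjective) hA' ?_ hlen))
      simpa [mul_assoc] using hB'

theorem eq_top_of_conj_genA_mem_of_conj_genB_mem (hM : IsProfinitelyDense M) {u w : GSGroup p}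
    (hu : u * genA p * u⁻¹ ∈ M) (hw : w * genB p * w⁻¹ ∈ M) : M = ⊤ := by
  obtain ⟨_, hn⟩ := BLengthLE.exists_of_group (u⁻¹ * w)
  refine eq_top_of_comap_conj_eq_top (s := u)
    (eq_top_of_genA_mem (hM.comap (MulAut.conj u).surjective) hu ?_ hn)
  simpa [mul_assoc] using hw

theorem eq_top_of_conj_genB_mem (hM : IsProfinitelyDense M) {g : GSGroup p}
    (hg : g * genB p * g⁻¹ ∈ M) : M = ⊤ := by
  obtain ⟨r, hrM, hr⟩ := exists_rot_ne_zero hM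
  obtain ⟨t, ht, htr⟩ := exists_rot_eq hrM hr 1
  have hA := sec_conj_genB_mem_secSub hg 0
  have hB := conj_mem_secSub (Subgroup.le_normalizer ht) (sec_conj_genB_mem_secSub hg (-1))
  rw [secB_zero] at hA
  rw [secB_neg_one, htr, add_right_comm, neg_add_cancel] at hB
  refine eq_top_of_secSub_eq_top hM
    (eq_top_of_conj_genA_mem_of_conj_genB_mem (isProfinitelyDense_secSub hM _) hA
      (w := sec t (-1 + rot g) * sec g (-1)) ?_)
  simpa [mul_assoc] using hB

theorem eq_top_of_bexp_ne_zero (hM : IsProfinitelyDense M) {n : ℕ} {y : GSGroup p} (hy : y ∈ M)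
    (hr : rot y = 0) (hb : bexp y ≠ 0) (hn : BLengthLE n y) : M = ⊤ := by
  induction n using Nat.strong_induction_on generalizing M y with
  | _ n ih =>
    rcases lt_or_ge 1 n with h1 | h1
    · obtain ⟨i, hi⟩ : ∃ i, bexp (sec y i) ≠ 0 := by
        by_contra! h
        exact hb (by rw [← sum_bexp_sec, Fintype.sum_eq_zero _ h])
      have hlt : (n + 1) / 2 < n := by omega
      have hz : sec y i ∈ secSub M i := mem_secSub.2 ⟨y, hy, hr, rfl⟩
      have hD := isProfinitelyDense_secSub hM i
      refine eq_top_of_secSub_eq_top hM (i := i) ?_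
      by_cases hzr : rot (sec y i) = 0
      · exact ih _ hlt hD hz hzr hi (hn.sec i)
      · refine eq_top_of_secSub_eq_top hD (i := 0) ?_
        exact ih _ hlt (isProfinitelyDense_secSub hD 0)
          (mem_secSub.2 ⟨_, pow_mem hz p, by simp, rfl⟩) (rot_sec_pow_self hzr 0)
          (by rwa [bexp_sec_pow_self hzr]) ((hn.sec i).sec_pow_self hzr 0)
    · obtain ⟨l, e, rfl⟩ := (hn.mono h1).exists_eq_conj_genB_zpow hr
      have he : (e : ZMod p) ≠ 0 := by simpa using hb
      obtain ⟨m, hm⟩ := exists_zpow_zpow_eq_self genB_pow he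
      have hB := M.zpow_mem hy m
      rw [conj_zpow, hm] at hB
      exact eq_top_of_conj_genB_mem hM hB

theorem eq_top_of_isProfinitelyDense (hM : IsProfinitelyDense M) : M = ⊤ := by
  obtain ⟨y, hy, hr, hb⟩ := exists_rot_eq_zero_and_bexp_ne_zero hM
  obtain ⟨n, hn⟩ := BLengthLE.exists_of_group y
  exact eq_top_of_bexp_ne_zero hM hy hr hb hn

theorem isTameGroup : IsTameGroup (GSGroup p) :=
  ⟨fun _ => eq_top_of_isProfinitelyDense, hasResiduallyFiniteQuotients_bot⟩

end OddDense

/-! ### Subgroups of finite index -/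

theorem isTameGroup_of_secSub [NeZero p] {M : Subgroup (GSGroup p)}
    (h : ∀ i, IsTameGroup (secSub M i)) : IsTameGroup M := by
  have hsub : IsTameGroup (M.subgroupOf (firstStab p)) := by
    refine .of_subdirect h (fun i => (secHom i).subgroupMap _)
      (fun i => MonoidHom.subgroupMap_surjective _ _) ?_
    refine (Subgroup.eq_bot_iff_forall _).2 fun g hg => Subtype.ext (Subtype.ext ?_)
    exact eq_one_of_rot_of_sec g.1.2 fun i => congrArg Subtype.val (Subgroup.mem_iInf.1 hg i)
  have := finiteIndex_comap (firstStab p) M.subtype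
  refine .of_finiteIndex ((firstStab p).subgroupOf M) (hsub.of_mulEquiv ?_)
  exact
    { toFun x := ⟨⟨x.1, x.2⟩, x.1.2⟩
      invFun x := ⟨⟨x.1, x.2⟩, x.1.2⟩
      map_mul' _ _ := rfl }

section FiniteIndex

variable [Fact p.Prime] [Fact (2 < p)]

instance finiteIndex_secSub (N : Subgroup (GSGroup p)) [N.FiniteIndex] (i : ZMod p) :
    (secSub N i).FiniteIndex :=
  have := finiteIndex_comap N (firstStab p).subtype
  finiteIndex_map _ (secHom_surjective i)

theorem index_secSub_lt {N : Subgroup (GSGroup p)} [N.FiniteIndex] (h : N ≤ firstStab p)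
    (i : ZMod p) : (secSub N i).index < N.index := by
  have hdvd : (secSub N i).index ∣ N.relIndex (firstStab p) :=
    Subgroup.index_map_dvd _ (secHom_surjective i)
  have hmul := Subgroup.relIndex_mul_index h
  have hrel : 0 < N.relIndex (firstStab p) :=
    Nat.pos_of_ne_zero (relIndex_ne_zero_of_finiteIndex N _)
  have hone : 1 < (firstStab p).index := by
    refine Subgroup.one_lt_index_of_ne_top fun htop => ?_
    have hA : genA p ∈ firstStab p := htop ▸ Subgroup.mem_top _
    exact one_ne_zero (rot_genA.symm.trans (mem_firstStab.1 hA))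
  exact (Nat.le_of_dvd hrel hdvd).trans_lt (hmul ▸ lt_mul_of_one_lt_right hrel hone)

instance secSub_normal (N : Subgroup (GSGroup p)) [N.Normal] (i : ZMod p) :
    (secSub N i).Normal where
  conj_mem x hx g := by
    obtain ⟨Y, hY, rfl⟩ := exists_sec_eq i g
    have hnorm : Y ∈ Subgroup.normalizer (N : Set (GSGroup p)) :=
      Subgroup.normalizer_eq_top N ▸ Subgroup.mem_top Y
    simpa [hY] using conj_mem_secSub hnorm hx

theorem commutator_le_secSub {N : Subgroup (GSGroup p)} [N.Normal] {g : GSGroup p} (hg : g ∈ N)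
    (hr : rot g ≠ 0) (i : ZMod p) : commutator (GSGroup p) ≤ secSub N i := by
  intro x hx
  obtain ⟨X, -, hX⟩ := exists_mem_commutator_isAt i (inv_mem hx)
  refine mem_secSub.2 ⟨⁅g, X⁆, ?_, rot_commutatorElement g X, ?_⟩
  · exact Subgroup.commutator_le_left N ⊤
      (Subgroup.commutator_mem_commutator hg (Subgroup.mem_top X))
  · rw [hX.sec_commutatorElement_of_rot_ne_zero hr, inv_inv]

theorem secSub_eq_top_of_commutator_le {N : Subgroup (GSGroup p)} [N.Normal]
    (h : commutator (GSGroup p) ≤ N) (i : ZMod p) : secSub N i = ⊤ := by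
  have hN : conjB 0 * (conjB 1)⁻¹ ∈ N :=
    h (mem_commutator_of_rot_of_bexp (by simp) (by simp [conjB]))
  have hsec (j) : secB j * (secB (j - 1))⁻¹ ∈ secSub N i :=
    secSub_le_secSub_of_genA_mem (Subgroup.normalizer_eq_top N ▸ Subgroup.mem_top _) j i
      (mem_secSub.2 ⟨_, hN, by simp, by simp⟩)
  have hA : genA p ∈ secSub N i := by
    have hsq : genA p ^ (-2 : ℤ) ∈ secSub N i := by
      simpa [zpow_neg, zpow_ofNat, pow_two] using hsec 1
    obtain ⟨m, hm⟩ := exists_zpow_zpow_eq_self (k := -2) (genA_pow (p := p))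
      (by simpa using two_ne_zero_zmod)
    exact hm ▸ zpow_mem hsq m
  have hB : genB p ∈ secSub N i := by
    have hAB : genA p * (genB p)⁻¹ ∈ secSub N i := by simpa using hsec 0
    simpa using mul_mem (inv_mem hAB) hA
  rw [eq_top_iff, ← closure_generators, Subgroup.closure_le]
  rintro _ (rfl | rfl)
  exacts [hA, hB]

/- A normal subgroup that moves the first level has sections containing the commutator subgroup, and
the sections of these are the whole group. -/
theorem isTameGroup_of_normal (N : Subgroup (GSGroup p)) [N.Normal] [N.FiniteIndex] :
    IsTameGroup N := by
  induction hn : N.index using Nat.strong_induction_on generalizing N with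
  | _ n ih =>
    refine isTameGroup_of_secSub fun i => ?_
    by_cases h : N ≤ firstStab p
    · exact ih _ (hn ▸ index_secSub_lt h i) _ rfl
    · obtain ⟨g, hg, hr⟩ := SetLike.not_le_iff_exists.1 h
      refine isTameGroup_of_secSub fun j => ?_
      rw [secSub_eq_top_of_commutator_le (commutator_le_secSub hg hr i)]
      exact isTameGroup.of_mulEquiv Subgroup.topEquiv.symm

theorem isTameGroup_of_finiteIndex (M : Subgroup (GSGroup p)) [M.FiniteIndex] : IsTameGroup M :=
  .of_le (Subgroup.normalCore_le M) (relIndex_ne_zero_of_finiteIndex _ M) (isTameGroup_of_normal _)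

theorem isTameGroup_of_abstractlyCommensurable {ι H : Type*} [Finite ι] [Group H]
    (h : AbstractlyCommensurable H (ι → GSGroup p)) : IsTameGroup H := by
  obtain ⟨K, L, _, _, ⟨e⟩⟩ := h
  let proj (i : ι) : (ι → GSGroup p) →* GSGroup p := Pi.evalMonoidHom _ i
  have hproj (i) : Function.Surjective (proj i) := fun x => ⟨fun _ => x, rfl⟩
  have hL : IsTameGroup L := by
    refine .of_subdirect (A := fun i => L.map (proj i)) (fun i => ?_)
      (fun i => (proj i).subgroupMap L) (fun i => MonoidHom.subgroupMap_surjective _ _) ?_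
    · have := finiteIndex_map L (hproj i)
      exact isTameGroup_of_finiteIndex _
    · refine (Subgroup.eq_bot_iff_forall _).2 fun x hx => Subtype.ext (funext fun i => ?_)
      exact congrArg Subtype.val (Subgroup.mem_iInf.1 hx i)
  exact .of_finiteIndex K (hL.of_mulEquiv e.symm)

end FiniteIndex

/-! ### Hereditarily tame subgroups -/

theorem relIndex_secSub_ne_zero {K H : Subgroup (GSGroup p)} (h : K.relIndex H ≠ 0) (i : ZMod p) :
    (secSub K i).relIndex (secSub H i) ≠ 0 := by
  unfold secSub
  rw [← Subgroup.relIndex_comap]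
  exact ne_zero_of_dvd_ne_zero (Subgroup.relIndex_comap_ne_zero (firstStab p).subtype h)
    (Subgroup.relIndex_dvd_of_le_left _ (Subgroup.le_comap_map _ _))

theorem isHereditarilyTame_of_secSub [NeZero p] {L : Subgroup (GSGroup p)}
    (h : ∀ i, IsHereditarilyTame (secSub L i)) : IsHereditarilyTame L := fun _ hK hrel =>
  isTameGroup_of_secSub fun i =>
    h i _ (Subgroup.map_mono (Subgroup.comap_mono hK)) (relIndex_secSub_ne_zero hrel i)

theorem map_conj_secSub {M : Subgroup (GSGroup p)} {t : GSGroup p}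
    (ht : t ∈ Subgroup.normalizer (M : Set (GSGroup p))) (i : ZMod p) :
    (secSub M i).map (MulAut.conj (sec t i)).toMonoidHom = secSub M (i + rot t) := by
  refine le_antisymm ?_ fun x hx => ?_
  · rintro _ ⟨x, hx, rfl⟩
    exact conj_mem_secSub ht hx
  · refine ⟨_, by simpa using conj_mem_secSub (inv_mem ht) hx, by simp [mul_assoc]⟩

theorem isHereditarilyTame_of_secSub_of_rot_ne_zero [Fact p.Prime] {L : Subgroup (GSGroup p)}
    {g : GSGroup p} (hg : g ∈ L) (hr : rot g ≠ 0) {c : ZMod p}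
    (h : IsHereditarilyTame (secSub L c)) : IsHereditarilyTame L := by
  refine isHereditarilyTame_of_secSub fun j => ?_
  obtain ⟨t, ht, htr⟩ := exists_rot_eq hg hr (j - c)
  have hmap := map_conj_secSub (Subgroup.le_normalizer ht) c
  rw [htr, add_sub_cancel] at hmap
  rw [← hmap]
  exact h.map (MulAut.conj _).injective

theorem exists_mem_rot_eq_and_bexp_eq [Fact p.Prime] {M : Subgroup (GSGroup p)}
    {u w : GSGroup p} (hu : u ∈ M) (hw : w ∈ M) (h : rot u * bexp w - rot w * bexp u ≠ 0)
    (r e : ZMod p) : ∃ x ∈ M, rot x = r ∧ bexp x = e := by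
  set d := rot u * bexp w - rot w * bexp u with hd
  let k : ℤ := ((r * bexp w - e * rot w) / d).val
  let l : ℤ := ((rot u * e - bexp u * r) / d).val
  refine ⟨u ^ k * w ^ l, M.mul_mem (M.zpow_mem hu k) (M.zpow_mem hw l), ?_, ?_⟩
  · simp only [k, l, rot_mul, rot_zpow, Int.cast_natCast, ZMod.natCast_zmod_val]
    field_simp
    rw [hd]
    ring
  · simp only [k, l, bexp_mul, bexp_zpow, Int.cast_natCast, ZMod.natCast_zmod_val]
    field_simp
    rw [hd]
    ring

section OddHereditary

variable [Fact p.Prime] [Fact (2 < p)]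

/- By Cramer's rule `M` maps onto the abelianization, and a proper tame subgroup cannot, because
every maximal subgroup of a finite `p`-group contains the commutator subgroup. -/
theorem eq_top_of_det_ne_zero {M : Subgroup (GSGroup p)} {u w : GSGroup p} (hu : u ∈ M)
    (hw : w ∈ M) (h : rot u * bexp w - rot w * bexp u ≠ 0) : M = ⊤ := by
  refine isTameGroup.eq_top_of_sup_commutator_eq_top isPGroup (top_le_iff.1 fun g _ => ?_)
  obtain ⟨x, hx, hr, he⟩ := exists_mem_rot_eq_and_bexp_eq hu hw h (rot g) (bexp g)
  have hcomm : x⁻¹ * g ∈ commutator (GSGroup p) :=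
    mem_commutator_of_rot_of_bexp (by simp [hr]) (by simp [he])
  simpa using Subgroup.mul_mem_sup hx hcomm

theorem isHereditarilyTame_top : IsHereditarilyTame (⊤ : Subgroup (GSGroup p)) := fun K _ hK =>
  have : K.FiniteIndex := ⟨by rwa [Subgroup.relIndex_top_right] at hK⟩
  isTameGroup_of_finiteIndex K

theorem isHereditarilyTame_of_le_zpowers {L : Subgroup (GSGroup p)} {x : GSGroup p}
    (h : L ≤ Subgroup.zpowers x) : IsHereditarilyTame L := by
  have : Finite (Subgroup.zpowers x) := (isOfFinOrder x).finite_zpowers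
  have := Finite.of_injective _ (Subgroup.inclusion_injective h)
  exact .of_finite L

theorem isHereditarilyTame_of_le_closure {L : Subgroup (GSGroup p)} (h : L ≤ Subgroup.closure
      {x | x ∈ L ∧ (x ∈ Subgroup.zpowers (genA p) ∨ x ∈ Subgroup.zpowers (genB p))}) :
    IsHereditarilyTame L := by
  by_cases hA : ∃ k : ℤ, genA p ^ k ∈ L ∧ (k : ZMod p) ≠ 0
  · by_cases hB : ∃ e : ℤ, genB p ^ e ∈ L ∧ (e : ZMod p) ≠ 0
    · obtain ⟨k, hk, hk0⟩ := hA
      obtain ⟨e, he, he0⟩ := hB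
      rw [eq_top_of_det_ne_zero hk he (by simp [hk0, he0])]
      exact isHereditarilyTame_top
    · push Not at hB
      refine isHereditarilyTame_of_le_zpowers (x := genA p) (h.trans ((Subgroup.closure_le _).2 ?_))
      rintro x ⟨hx, hxA | ⟨e, rfl⟩⟩
      · exact hxA
      · simp [zpow_eq_one_of_intCast_eq_zero genB_pow (hB e hx)]
  · push Not at hA
    refine isHereditarilyTame_of_le_zpowers (x := genB p) (h.trans ((Subgroup.closure_le _).2 ?_))
    rintro x ⟨hx, ⟨k, rfl⟩ | hxB⟩
    · simp [zpow_eq_one_of_intCast_eq_zero genA_pow (hA k hx)]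
    · exact hxB

end OddHereditary

/-! ### Subgroups generated in bounded length -/

/-- The subgroup `H` is generated by its elements of length at most `n`. -/
def IsBLengthGenerated (n : ℕ) (H : Subgroup (GSGroup p)) : Prop :=
  H ≤ Subgroup.closure {s | s ∈ H ∧ BLengthLE n s}

theorem exists_isBLengthGenerated {H : Subgroup (GSGroup p)} (hH : H.FG) :
    ∃ n, IsBLengthGenerated n H := by
  obtain ⟨S, rfl⟩ := hH
  choose ℓ hℓ using BLengthLE.exists_of_group (p := p)
  exact ⟨S.sup ℓ, Subgroup.closure_mono fun s hs =>
    ⟨Subgroup.subset_closure hs, (hℓ s).mono (Finset.le_sup (f := ℓ) hs)⟩⟩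

theorem IsBLengthGenerated.mono {m n : ℕ} {H : Subgroup (GSGroup p)} (h : IsBLengthGenerated m H)
    (hmn : m ≤ n) : IsBLengthGenerated n H :=
  h.trans (Subgroup.closure_mono fun _ hs => ⟨hs.1, hs.2.mono hmn⟩)

theorem secSub_le_closure {H : Subgroup (GSGroup p)} {S : Set (GSGroup p)}
    (hS : S ⊆ firstStab p) (hHS : H ≤ Subgroup.closure S) (i : ZMod p) :
    secSub H i ≤ Subgroup.closure ((sec · i) '' S) := by
  have hlift : H ≤ ((Subgroup.closure ((sec · i) '' S)).comap (secHom i)).map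
      (firstStab p).subtype :=
    hHS.trans ((Subgroup.closure_le _).2 fun s hs =>
      ⟨⟨s, hS hs⟩, Subgroup.subset_closure ⟨s, hs, rfl⟩, rfl⟩)
  intro x hx
  obtain ⟨g, hg, _, rfl⟩ := mem_secSub.1 hx
  obtain ⟨y, hy, rfl⟩ := hlift hg
  exact hy

section Transversal

variable {H : Subgroup (GSGroup p)} {c : ZMod p} {T : ZMod p → GSGroup p}

/- Schreier's generators of the stabilizer of the letter `c`, followed by the section at `c`. -/
theorem secSub_le_closure_of_transversal {S : Set (GSGroup p)} (hS : H ≤ Subgroup.closure S)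
    (hT : T c = 1) : secSub H c ≤ Subgroup.closure
      {x | ∃ s ∈ S, ∃ i, x = (sec (T (i + rot s)) c)⁻¹ * sec s i * sec (T i) c} := by
  set C := Subgroup.closure
    {x | ∃ s ∈ S, ∃ i, x = (sec (T (i + rot s)) c)⁻¹ * sec s i * sec (T i) c}
  have hmem (h : GSGroup p) (hh : h ∈ Subgroup.closure S) (i : ZMod p) :
      (sec (T (i + rot h)) c)⁻¹ * sec h i * sec (T i) c ∈ C := by
    induction hh using Subgroup.closure_induction generalizing i with
    | mem s hs => exact Subgroup.subset_closure ⟨s, hs, i, rfl⟩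
    | one => simp
    | mul x y _ _ hx hy =>
      have hxy := C.mul_mem (hx (i + rot y)) (hy i)
      rw [add_assoc, add_comm (rot y), ← rot_mul] at hxy
      simpa [mul_assoc] using hxy
    | inv x _ hx => simpa [mul_assoc, sub_eq_add_neg] using C.inv_mem (hx (i - rot x))
  intro x hx
  obtain ⟨g, hg, hr, rfl⟩ := mem_secSub.1 hx
  simpa [hr, hT] using hmem g (hS hg) c

theorem inv_mul_sec_mul_mem_secSub (hTH : ∀ i, T i ∈ H) (hTr : ∀ i, rot (T i) = i - c)
    {s : GSGroup p} (hs : s ∈ H) (i : ZMod p) :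
    (sec (T (i + rot s)) c)⁻¹ * sec s i * sec (T i) c ∈ secSub H c := by
  refine mem_secSub.2 ⟨(T (i + rot s))⁻¹ * s * T i,
    H.mul_mem (H.mul_mem (H.inv_mem (hTH _)) hs) (hTH i), ?_, ?_⟩
  · simp only [rot_mul, rot_inv, hTr]
    ring
  · simp only [sec_mul, sec_inv, hTr]
    rw [add_sub_cancel, sub_sub_cancel]

theorem IsBLengthGenerated.secSub_of_transversal {n N : ℕ} (hH : IsBLengthGenerated n H)
    (hTH : ∀ i, T i ∈ H) (hTr : ∀ i, rot (T i) = i - c) (hT : T c = 1)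
    (hN : ∀ s ∈ H, BLengthLE n s → ∀ i,
      BLengthLE N ((sec (T (i + rot s)) c)⁻¹ * sec s i * sec (T i) c)) :
    IsBLengthGenerated N (GuptaSidki.secSub H c) := by
  refine (secSub_le_closure_of_transversal hH hT).trans (Subgroup.closure_mono ?_)
  rintro _ ⟨s, hs, i, rfl⟩
  exact ⟨inv_mul_sec_mul_mem_secSub hTH hTr hs.1 i, hN s hs.1 hs.2 i⟩

end Transversal

theorem BLengthLE.bexp_eq_zero [Fact p.Prime] {g : GSGroup p} (h : BLengthLE 0 g) :
    bexp g = 0 := by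
  cases h
  simp

section OddGenerated

variable [Fact p.Prime] [Fact (2 < p)]

theorem IsBLengthGenerated.secSub {H : Subgroup (GSGroup p)} {n : ℕ} (hn : IsBLengthGenerated n H)
    (hH : H ≤ firstStab p) (i : ZMod p) :
    IsBLengthGenerated ((n + 1) / 2) (GuptaSidki.secSub H i) := by
  refine (secSub_le_closure (fun s hs => hH hs.1) hn i).trans (Subgroup.closure_mono ?_)
  rintro _ ⟨s, hs, rfl⟩
  exact ⟨mem_secSub.2 ⟨s, hs.1, hH hs.1, rfl⟩, hs.2.sec i⟩

theorem secB_mem_zpowers (i : ZMod p) :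
    secB i ∈ Subgroup.zpowers (genA p) ∨ secB i ∈ Subgroup.zpowers (genB p) := by
  induction i using secB_cases <;> simp

theorem BLengthLE.sec_mem_zpowers {s : GSGroup p} (hs : BLengthLE 1 s) (hr : rot s = 0)
    (i : ZMod p) : GuptaSidki.sec s i ∈ Subgroup.zpowers (genA p) ∨
      GuptaSidki.sec s i ∈ Subgroup.zpowers (genB p) := by
  obtain ⟨l, e, rfl⟩ := hs.exists_eq_conj_genB_zpow hr
  simp only [sec_mul, sec_inv, sec_genA_zpow, sec_zpow rot_genB, sec_genB, inv_one, one_mul,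
    mul_one]
  exact (secB_mem_zpowers _).imp (zpow_mem · e) (zpow_mem · e)

theorem IsBLengthGenerated.isHereditarilyTame_of_le_one {H : Subgroup (GSGroup p)} {n : ℕ}
    (hn : IsBLengthGenerated n H) (hn1 : n ≤ 1) (hH : H ≤ firstStab p) : IsHereditarilyTame H := by
  refine isHereditarilyTame_of_secSub fun i => isHereditarilyTame_of_le_closure ?_
  refine (secSub_le_closure (fun s hs => hH hs.1) (hn.mono hn1) i).trans (Subgroup.closure_mono ?_)
  rintro _ ⟨s, ⟨hs, hs1⟩, rfl⟩
  exact ⟨mem_secSub.2 ⟨s, hs, hH hs, rfl⟩, hs1.sec_mem_zpowers (hH hs) i⟩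

theorem BLengthLE.eq_one_of_bexp_eq_zero {g : GSGroup p} (h : BLengthLE 1 g) (hr : rot g = 0)
    (hb : bexp g = 0) : g = 1 := by
  obtain ⟨l, e, rfl⟩ := h.exists_eq_conj_genB_zpow hr
  rw [zpow_eq_one_of_intCast_eq_zero genB_pow (by simpa using hb), mul_one, mul_inv_cancel]

theorem bexp_sec_eq_of_rot_sec_eq_zero {s : GSGroup p} (h : ∀ i, rot (sec s i) = 0)
    (i j : ZMod p) : bexp (sec s i) = bexp (sec s j) := by
  have hper : Function.Periodic (fun i => bexp (sec s i)) 1 := fun i => by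
    have hi := h (i + 2)
    rw [rot_sec, add_sub_cancel_right, show i + 2 - 1 = i + 1 by ring] at hi
    exact sub_eq_zero.1 hi
  simpa using hper.nat_mul (i - j).val j

theorem BLengthLE.eq_one_of_rot_sec_eq_zero {s : GSGroup p} (hs : BLengthLE 2 s) (hr : rot s = 0)
    (h : ∀ i, rot (GuptaSidki.sec s i) = 0) : s = 1 := by
  obtain ⟨ν, hν, hsum⟩ := hs.exists_sum_le
  obtain ⟨j, hj⟩ : ∃ j, ν j = 0 := by
    by_contra! hne
    have hcard : p ≤ ∑ i, ν i := by
      simpa using Finset.card_nsmul_le_sum Finset.univ ν 1 fun i _ => Nat.pos_of_ne_zero (hne i)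
    exact absurd Fact.out (hcard.trans hsum).not_gt
  refine eq_one_of_rot_of_sec hr fun i => (hs.sec i).eq_one_of_bexp_eq_zero (h i) ?_
  rw [bexp_sec_eq_of_rot_sec_eq_zero h i j]
  exact (hj ▸ hν j).bexp_eq_zero

theorem bexp_eq_zero_of_ne_top {H : Subgroup (GSGroup p)} (hH : H ≠ ⊤) {g s : GSGroup p}
    (hg : g ∈ H) (hgr : rot g ≠ 0) (hs : s ∈ H) (hsr : rot s = 0) : bexp s = 0 := by
  by_contra hb
  exact hH (eq_top_of_det_ne_zero hg hs (by simp [hsr, hgr, hb]))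

theorem det_sec_eq_zero {H : Subgroup (GSGroup p)} {g s : GSGroup p} (hg : g ∈ H)
    (hgr : rot g ≠ 0) {c : ZMod p} (hc : secSub H c ≠ ⊤) (hs : s ∈ H) (hsr : rot s = 0)
    (i j : ZMod p) : rot (sec s i) * bexp (sec s j) - rot (sec s j) * bexp (sec s i) = 0 := by
  have hconj (i : ZMod p) :
      ∃ x ∈ secSub H c, rot x = rot (sec s i) ∧ bexp x = bexp (sec s i) := by
    obtain ⟨t, ht, htr⟩ := exists_rot_eq hg hgr (c - i)
    have hmem := conj_mem_secSub (Subgroup.le_normalizer ht) (mem_secSub.2 ⟨s, hs, hsr, rfl⟩ :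
      sec s i ∈ secSub H i)
    rw [htr, add_sub_cancel] at hmem
    exact ⟨_, hmem, by simp, by simp⟩
  obtain ⟨x, hx, hxr, hxb⟩ := hconj i
  obtain ⟨y, hy, hyr, hyb⟩ := hconj j
  by_contra hdet
  exact hc (eq_top_of_det_ne_zero hx hy (by rwa [hxr, hxb, hyr, hyb]))

end OddGenerated

/-! ### The case `p = 3` -/

section Three

instance : Fact (2 < 3) := ⟨by norm_num⟩

theorem sum_zmod_three {A : Type*} [AddCommMonoid A] (f : ZMod 3 → A) (c : ZMod 3) :
    ∑ i, f i = f c + f (c + 1) + f (c - 1) := by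
  rw [← sum_comp_add_right f c]
  refine (Fin.sum_univ_three _).trans ?_
  congr 2
  · exact congrArg f (zero_add c)
  · exact congrArg f (add_comm 1 c)

theorem rot_sec_eq_zero {H : Subgroup (GSGroup 3)} (hH : H ≠ ⊤) {g : GSGroup 3} (hg : g ∈ H)
    (hgr : rot g ≠ 0) {c : ZMod 3} (hc : secSub H c ≠ ⊤) {s : GSGroup 3} (hs : s ∈ H)
    (hsr : rot s = 0) (i : ZMod 3) : rot (sec s i) = 0 := by
  have hsum : bexp (sec s i) + bexp (sec s (i + 1)) + bexp (sec s (i - 1)) = 0 := by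
    rw [← sum_zmod_three (fun i => bexp (sec s i)), sum_bexp_sec,
      bexp_eq_zero_of_ne_top hH hg hgr hs hsr]
  have hdet := det_sec_eq_zero hg hgr hc hs hsr i (i + 1)
  have hsucc : i - 2 = i + 1 := by rw [sub_eq_iff_eq_add, add_assoc, left_eq_add]; rfl
  have hadd : i + 1 - 2 = i - 1 := by ring
  rw [rot_sec s i, rot_sec s (i + 1), add_sub_cancel_right, hsucc, hadd] at hdet
  rw [rot_sec, hsucc, sub_eq_zero]
  have key : ∀ x y z : ZMod 3, x + y + z = 0 → (z - y) * y - (x - z) * x = 0 → z = y := by decide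
  exact key _ _ _ hsum hdet

/- Take for `c + 1` a letter at which the section of `g` is longest. -/
theorem BLengthLE.exists_transversal {n : ℕ} {g : GSGroup 3} (hg : BLengthLE n g)
    (hr : rot g = 1) : ∃ (c : ZMod 3) (T : ZMod 3 → GSGroup 3) (τ : ZMod 3 → ℕ), T c = 1 ∧
      (∀ i, T i ∈ Subgroup.zpowers g ∧ rot (T i) = i - c ∧
        BLengthLE (τ i) (GuptaSidki.sec (T i) c) ∧ 2 * τ i ≤ n) ∧ 3 * ∑ i, τ i ≤ 2 * n := by
  obtain ⟨ν, hν, hsum⟩ := hg.exists_sum_le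
  obtain ⟨m, hm⟩ := Finite.exists_max ν
  obtain ⟨c, rfl⟩ : ∃ c, m = c + 1 := ⟨m - 1, (sub_add_cancel m 1).symm⟩
  have hc := hm c
  have hc' := hm (c - 1)
  have hcases : ∀ i c : ZMod 3, i = c ∨ i = c + 1 ∨ i = c - 1 := by decide
  have hne : ∀ c : ZMod 3, c - 1 ≠ c + 1 := by decide
  let T : ZMod 3 → GSGroup 3 := fun i => if i = c then 1 else if i = c + 1 then g else g⁻¹
  let τ : ZMod 3 → ℕ := fun i => if i = c then 0 else if i = c + 1 then ν c else ν (c - 1)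
  have hτ₀ : τ c = 0 := by simp [τ]
  have hτ₁ : τ (c + 1) = ν c := by simp [τ]
  have hτ₂ : τ (c - 1) = ν (c - 1) := by simp [τ, hne]
  rw [sum_zmod_three ν c] at hsum
  refine ⟨c, T, τ, by simp [T], fun i => ?_, by rw [sum_zmod_three τ c]; omega⟩
  rcases hcases i c with rfl | rfl | rfl
  · simp [T, hτ₀, one_mem, one]
  · exact ⟨by simp [T], by simp [T, hr], by simpa [T, hτ₁] using hν c, by omega⟩
  · exact ⟨by simp [T, hne], by simp [T, hne, hr], by simpa [T, hτ₂, hne, hr] using (hν _).inv,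
      by omega⟩

theorem IsBLengthGenerated.exists_mem_rot_eq_one {n : ℕ} {H : Subgroup (GSGroup 3)}
    (hn : IsBLengthGenerated n H) (hH : ¬ H ≤ firstStab 3) :
    ∃ g ∈ H, BLengthLE n g ∧ rot g = 1 := by
  obtain ⟨g, hg, hgn, hr⟩ : ∃ g ∈ H, BLengthLE n g ∧ rot g ≠ 0 := by
    by_contra! h
    exact hH (hn.trans ((Subgroup.closure_le _).2 fun s hs => h s hs.1 hs.2))
  have hcases : ∀ r : ZMod 3, r ≠ 0 → r = 1 ∨ -r = 1 := by decide
  rcases hcases _ hr with h | h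
  · exact ⟨g, hg, hgn, h⟩
  · exact ⟨g⁻¹, H.inv_mem hg, hgn.inv, by rw [rot_inv, h]⟩

theorem IsBLengthGenerated.exists_secSub {n : ℕ} {H : Subgroup (GSGroup 3)}
    (hn : IsBLengthGenerated n H) (hH : H ≠ ⊤) {g : GSGroup 3} (hg : g ∈ H)
    (hgn : BLengthLE n g) (hr : rot g = 1) : ∃ c, GuptaSidki.secSub H c ≠ ⊤ →
      GuptaSidki.secSub H c ≤ firstStab 3 ∧
        ∃ N, (N ≤ 1 ∨ (N + 1) / 2 < n) ∧ IsBLengthGenerated N (GuptaSidki.secSub H c) := by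
  obtain ⟨c, T, τ, hTc, hT, hτ⟩ := hgn.exists_transversal hr
  refine ⟨c, fun hc => ?_⟩
  have hTH (i : ZMod 3) : T i ∈ H := Subgroup.zpowers_le.2 hg (hT i).1
  have hzero {s : GSGroup 3} (hs : s ∈ H) (hsr : rot s = 0) (i) : rot (sec s i) = 0 :=
    rot_sec_eq_zero hH hg (by simp [hr]) hc hs hsr i
  have hlen {s : GSGroup 3} (hs : BLengthLE n s) (i : ZMod 3) :=
    ((hT (i + rot s)).2.2.1.inv.mul (hs.sec i)).mul (hT i).2.2.1
  refine ⟨fun x hx => ?_, ?_⟩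
  · obtain ⟨s, hs, hsr, rfl⟩ := mem_secSub.1 hx
    exact hzero hs hsr c
  by_cases hn2 : n = 2
  · refine ⟨2, by omega, hn.secSub_of_transversal hTH (hT · |>.2.1) hTc fun s hs hsn i => ?_⟩
    by_cases hsr : rot s = 0
    · rw [(hsn.mono hn2.le).eq_one_of_rot_sec_eq_zero hsr (hzero hs hsr)]
      simpa using BLengthLE.one.mono zero_le_two
    · have hle : τ (i + rot s) + τ i ≤ ∑ j, τ j := Finset.add_le_sum (fun _ _ => Nat.zero_le _)
        (Finset.mem_univ _) (Finset.mem_univ _) (by simpa using hsr)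
      exact (hlen hsn i).mono (by omega)
  · refine ⟨(n + 1) / 2 + 2 * (n / 2), by omega,
      hn.secSub_of_transversal hTH (hT · |>.2.1) hTc fun s _ hsn i => (hlen hsn i).mono ?_⟩
    have hτs := (hT (i + rot s)).2.2.2
    have hτi := (hT i).2.2.2
    omega

theorem IsBLengthGenerated.isHereditarilyTame {n : ℕ} {H : Subgroup (GSGroup 3)}
    (hn : IsBLengthGenerated n H) : IsHereditarilyTame H := by
  induction n using Nat.strong_induction_on generalizing H with
  | _ n ih =>
    have of_le_firstStab {K : Subgroup (GSGroup 3)} {N : ℕ} (hK : K ≤ firstStab 3)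
        (hN : IsBLengthGenerated N K) (hNn : N ≤ 1 ∨ (N + 1) / 2 < n) : IsHereditarilyTame K := by
      rcases hNn with hN1 | hlt
      · exact hN.isHereditarilyTame_of_le_one hN1 hK
      · exact isHereditarilyTame_of_secSub fun i => ih _ hlt (hN.secSub hK i)
    by_cases hH : H = ⊤
    · exact hH ▸ isHereditarilyTame_top
    by_cases hst : H ≤ firstStab 3
    · exact of_le_firstStab hst hn (by omega)
    obtain ⟨g, hg, hgn, hr⟩ := hn.exists_mem_rot_eq_one hst
    obtain ⟨c, hc⟩ := hn.exists_secSub hH hg hgn hr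
    refine isHereditarilyTame_of_secSub_of_rot_ne_zero hg (by simp [hr]) (c := c) ?_
    by_cases htop : GuptaSidki.secSub H c = ⊤
    · exact htop ▸ isHereditarilyTame_top
    · obtain ⟨hle, N, hNn, hN⟩ := hc htop
      exact of_le_firstStab hle hN hNn

end Three

end GuptaSidki

theorem mainTheorem6 :
    (∀ (p : ℕ), p.Prime → Odd p → ∀ (k : ℕ) (H : Type*) [Group H],
      AbstractlyCommensurable H (Fin k → guptaSidkiGroup p) →
        ∀ M : Subgroup H, IsCoatom M → M.FiniteIndex) ∧
    (∀ H : Subgroup (guptaSidkiGroup 3), H.FG →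
      ∀ M : Subgroup H, IsCoatom M → M.FiniteIndex) := by
  constructor
  · intro p hp hodd k H _ hH M hM
    have : Fact p.Prime := ⟨hp⟩
    have : Fact (2 < p) := ⟨hp.two_le.lt_of_ne' (by rintro rfl; exact absurd hodd (by decide))⟩
    exact (GuptaSidki.isTameGroup_of_abstractlyCommensurable hH).finiteIndex_of_isCoatom hM
  · intro H hH M hM
    obtain ⟨n, hn⟩ := GuptaSidki.exists_isBLengthGenerated hH
    have htame : IsTameGroup H := hn.isHereditarilyTame H le_rfl (by simp)
    exact htame.finiteIndex_of_isCoatom hM
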